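/- **Setting.** Let $r>1$, $0<p<1$, $q=1-p$, and let $N=\mathrm{N}_{r,p}$ have the negative binomial distribution $\mathbb P(N=k)=\binom{r+k-1}{k}p^rq^k$, $k\in\mathbb Z_+=\{0,1,2,\dots\}$. For $x\in\mathbb R$ put $x^+=\max\{x,0\}$. For $z\ge 0$ let $g_z(0)=0$ and, for $k\ge1$, $$g_z(k)=-\sum_{j=k}^{\infty}\frac{r(r+1)\cdots(r+j-1)}{r(r+1)\cdots(r+k-1)}\,\frac{(k-1)!}{j!}\,q^{j-k}\bigl[(j-z)^+-\mathbb E[(N-z)^+]\bigr],$$ and let $\mathscr A g(k)=q(r+k)g(k+1)-k\,g(k)$ be the Stein operator of $N$ (so that $g_z$ solves $\mathscr A g_z(k)=(k-z)^+-\mathbb E[(N-z)^+]$). For $z>1$ put $$\vartheta_{r,p,z}=\frac{r+1}{z}\Bigl((1+q^{-1})p^{-(r+2)}-p^{-2}\Bigr).$$ Let $J$ be a finite set, let $(\zeta_i)_{i\in J}$ be independent $\mathbb Z_+$-valued random variables with $\mathbb E(\zeta_i^3)<\infty$, and let $V=\sum_{i\in J}\zeta_i$. Write $\gamma_{i,k}=\mathbb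 P(\zeta_i=k)$, $d_{TV}(X,Y)=\sup_{A\subseteq\mathbb Z_+}|\mathbb P(X\in A)-\mathbb P(Y\in A)|$, $\delta_j=\min\{\tfrac12,\,1-d_{TV}(\zeta_j,\zeta_j+1)\}$ and $\delta^*=\max_{j\in J}\delta_j$. Define $$U_1=\sum_{i\in J}\sum_{k=1}^{\infty}k\,\bigl|(p\,\mathbb E(\zeta_i)+qk)\gamma_{i,k}-(k+1)\gamma_{i,k+1}\bigr|,$$ $$U_2=\sqrt{\tfrac2\pi}\Bigl(\tfrac14+\sum_{j\in J}\delta_j-\delta^*\Bigr)^{-1/2}\Bigl\{\sum_{i\in J}\mathbb E(\zeta_i)\bigl|p\,\mathbb E(\zeta_i)^2+q\,\mathbb E(\zeta_i^2)-\mathbb E(\zeta_i(\zeta_i-1))\bigr|+\sum_{i\in J}\sum_{k=2}^{\infty}\frac{k(k-1)}2\bigl|(p\,\mathbb E(\zeta_i)+qk)\gamma_{i,k}-(k+1)\gamma_{i,k+1}\bigr|\Bigr\}.$$ **Theorem 3.2.** All series above converge and $\mathscr A g_z(V)$ is integrable for every $z\ge0$. Moreover, if $\mathbb E(N)=\mathbb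 E(V)$, then the following holds with $U_J^*=U_1$; and if $\mathbb E(N)=\mathbb E(V)$ and $\mathrm{Var}(N)=\mathrm{Var}(V)$, then it also holds with $U_J^*=U_2$: 1. (uniform bound) $\displaystyle\sup_{z\ge0}\bigl|\mathbb E[\mathscr A g_z(V)]\bigr|\le\bigl(2p^{-(r+1)}-p^{-1}\bigr)U_J^*$; 2. (non-uniform bound) $\bigl|\mathbb E[\mathscr A g_z(V)]\bigr|\le\vartheta_{r,p,z}\,U_J^*$ for all $z>1$. -/

import Mathlib

open MeasureTheory ProbabilityTheory

noncomputable section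

namespace NBCall

/-- The negative binomial distribution with real parameter `r > 0` and `p ∈ (0, 1)`, as a measure
on `ℕ`: the point `k` has mass `binom(r + k - 1, k) p ^ r (1 - p) ^ k`, where the binomial
coefficient is the generalized one, `r (r + 1) ⋯ (r + k - 1) / k!`. -/
def nbMeasure (r p : ℝ) : Measure ℕ :=
  Measure.sum fun k : ℕ =>
    ENNReal.ofReal (Ring.choose (r + k - 1) k * p ^ r * (1 - p) ^ k) • Measure.dirac k

/-- The call function `f_z(k) = (k - z)⁺`. -/
def callFn (z : ℝ) (k : ℕ) : ℝ := max ((k : ℝ) - z) 0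

/-- `𝔼[(N - z)⁺]` for a negative binomial `N`. -/
def nbCall (r p z : ℝ) : ℝ := ∫ k, callFn z k ∂(nbMeasure r p)

/-- The `j`-th term (`1 ≤ k ≤ j`) of the series that defines `- g_z(k)`. -/
def steinTerm (r p z : ℝ) (k j : ℕ) : ℝ :=
  ((∏ i ∈ Finset.range j, (r + i)) / (∏ i ∈ Finset.range k, (r + i)))
    * (((k - 1).factorial : ℝ) / (j.factorial : ℝ)) * (1 - p) ^ (j - k)
    * (callFn z j - nbCall r p z)

/-- The solution `g_z` of the Stein equation: `g_z(0) = 0`, and for `k ≥ 1` it is minus the sum of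
`steinTerm r p z k j` over all `j ≥ k` (written `j = k + m`). -/
def steinSol (r p z : ℝ) (k : ℕ) : ℝ :=
  if k = 0 then 0 else - ∑' m : ℕ, steinTerm r p z k (k + m)

/-- The Stein operator `(𝒜 g)(k) = q (r + k) g(k + 1) - k g(k)`, `q = 1 - p`. -/
def steinOp (r p : ℝ) (g : ℕ → ℝ) (k : ℕ) : ℝ :=
  (1 - p) * (r + k) * g (k + 1) - k * g k

/-- `ϑ_{r,p,z} = (r + 1) / z * ((1 + q⁻¹) p^{-(r+2)} - p^{-2})`, `q = 1 - p`. -/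
def theta (r p z : ℝ) : ℝ :=
  (r + 1) / z * ((1 + (1 - p)⁻¹) * p ^ (-(r + 2)) - p ^ (-2 : ℝ))

/-- Total variation distance `sup_A |μ(A) - ν(A)|` of two laws on `ℕ` (all sets are measurable). -/
def dTV (μ ν : Measure ℕ) : ℝ := ⨆ A : Set ℕ, |μ.real A - ν.real A|

variable {Ω ι : Type*} [MeasurableSpace Ω]

/-- `𝔼 X` for an `ℕ`-valued random variable. -/
def mean (μ : Measure Ω) (X : Ω → ℕ) : ℝ := ∫ ω, (X ω : ℝ) ∂μ

/-- `Var X` for an `ℕ`-valued random variable. -/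
def var (μ : Measure Ω) (X : Ω → ℕ) : ℝ := variance (fun ω => (X ω : ℝ)) μ

/-- `γ_k = ℙ(X = k)`. -/
def gam (μ : Measure Ω) (X : Ω → ℕ) (k : ℕ) : ℝ := μ.real {ω | X ω = k}

/-- `δ = min {1/2, 1 - d_TV(X, X + 1)}`. -/
def delta (μ : Measure Ω) (X : Ω → ℕ) : ℝ :=
  min (1 / 2) (1 - dTV (μ.map X) (μ.map fun ω => X ω + 1))

/-- The coefficient `(p 𝔼X + q k) γ_k - (k + 1) γ_{k+1}`, `q = 1 - p`. -/
def coeff (μ : Measure Ω) (p : ℝ) (X : Ω → ℕ) (k : ℕ) : ℝ :=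
  (p * mean μ X + (1 - p) * k) * gam μ X k - (k + 1) * gam μ X (k + 1)

/-- The quantity `U*` under mean matching (the summand with `k = 0` is zero). -/
def U₁ [Fintype ι] (μ : Measure Ω) (p : ℝ) (ζ : ι → Ω → ℕ) : ℝ :=
  ∑ i, ∑' k : ℕ, (k : ℝ) * |coeff μ p (ζ i) k|

/-- The smoothness factor `√(2/π) (1/4 + ∑ δ_j - δ*)^{-1/2}`, `δ* = max_j δ_j`. -/
def smooth [Fintype ι] (μ : Measure Ω) (ζ : ι → Ω → ℕ) : ℝ :=
  Real.sqrt (2 / Real.pi) *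
    (1 / 4 + ∑ j, delta μ (ζ j) - ⨆ j, delta μ (ζ j)) ^ (-(1 / 2) : ℝ)

/-- The quantity `U*` under mean and variance matching (the summands with `k = 0, 1` in the series
are zero). -/
def U₂ [Fintype ι] (μ : Measure Ω) (p : ℝ) (ζ : ι → Ω → ℕ) : ℝ :=
  smooth μ ζ *
    (∑ i, mean μ (ζ i) *
        |p * mean μ (ζ i) ^ 2 + (1 - p) * (∫ ω, (ζ i ω : ℝ) ^ 2 ∂μ)
          - ∫ ω, (ζ i ω : ℝ) * ((ζ i ω : ℝ) - 1) ∂μ|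
      + ∑ i, ∑' k : ℕ, (k : ℝ) * ((k : ℝ) - 1) / 2 * |coeff μ p (ζ i) k|)

end NBCall

end

open NBCall

namespace NBCall

/-! ### The negative binomial weights -/

/-! Write π for the negative binomial weights, q = 1 - p and C = 𝔼(N - z)⁺.

Stein factors. The solution satisfies k π_k (-g(k)) = ∑_{j<k} π_j (C - (j - z)⁺) (`mul_steinSol`).
The identity ∑_{j≥k} π_j (p j - r q) = k π_k turns this into closed forms on either side of z, and
these show that g decreases on k ≥ 1 and takes values in [-1/p, 0]. Hence g(k) - g(k+1) ≤ 1/p, which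
is below the uniform constant. For decay in z, the assumption r > 1 gives π_k ≤ p ℙ(N ≥ k)
(`nbPmf_le_tail`), and then g(k) - g(k+1) ≤ (r+1)/(p² z) for k ≥ 1 (`mul_steinSol_sub_le`), which is
below ϑ.

Expansion. Mean matching means r q = p ∑ 𝔼ζ_i, so 𝒜g(V) splits into one part per ζ_i. With W_i = V -
ζ_i, conditioning on ζ_i writes the expectation of the part as ∑_k c_k 𝔼g(k+1+W_i). The c_k sum to
zero, so first differences of g suffice and give U₁. Variance matching makes the first moments of
the c_k cancel after summation over i, so only second differences of x ↦ 𝔼g(x+W_i) remain.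

Smoothing. Such a second difference is the change of 𝔼φ(x+W_i) under a unit translation, where φ is
an increment of g and has oscillation at most M, the bound on the increments. The Mineka coupling
(`coupling_step`, `abs_integral_shift_sub_le`) bounds it by M times the probability that a lazy
symmetric walk started at 1 avoids 0. That probability is an explicit trigonometric integral, and
`survival_one_le` estimates it by the factor in U₂. -/

/-- The negative binomial probability mass function. -/
noncomputable def nbPmf (r p : ℝ) (k : ℕ) : ℝ :=
  (∏ i ∈ Finset.range k, (r + i)) / (k.factorial : ℝ) * p ^ r * (1 - p) ^ k

lemma choose_eq_prod_div (r : ℝ) (k : ℕ) :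
    Ring.choose (r + k - 1) k = (∏ i ∈ Finset.range k, (r + i)) / (k.factorial : ℝ) := by
  have hprod : (ascPochhammer ℝ k).eval r = ∏ i ∈ Finset.range k, (r + i) := by
    induction k with
    | zero => simp
    | succ k ih => rw [ascPochhammer_succ_eval, Finset.prod_range_succ, ih]
  have h := Ring.factorial_nsmul_multichoose_eq_ascPochhammer r k
  rw [nsmul_eq_mul, Polynomial.ascPochhammer_smeval_cast,
    Polynomial.ascPochhammer_smeval_eq_eval] at h
  rw [← Ring.multichoose_eq, eq_div_iff (by positivity), mul_comm, h, hprod]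

lemma nbPmf_pos {r p : ℝ} (hr : 0 < r) (hp0 : 0 < p) (hp1 : p < 1) (k : ℕ) :
    0 < nbPmf r p k := by
  have h1 : 0 < 1 - p := by linarith
  have h2 : 0 < ∏ i ∈ Finset.range k, (r + i) := Finset.prod_pos fun i _ => by positivity
  unfold nbPmf
  positivity

lemma nbPmf_succ (r p : ℝ) (k : ℕ) :
    ((k : ℝ) + 1) * nbPmf r p (k + 1) = (1 - p) * (r + k) * nbPmf r p k := by
  unfold nbPmf
  rw [Finset.prod_range_succ, Nat.factorial_succ, pow_succ]
  push_cast
  field_simp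

lemma nbPmf_succ_shift {r p : ℝ} (hp0 : 0 < p) (k : ℕ) :
    ((k : ℝ) + 1) * nbPmf r p (k + 1) = r * (1 - p) / p * nbPmf (r + 1) p k := by
  unfold nbPmf
  rw [Finset.prod_range_succ', Nat.factorial_succ, pow_succ, Real.rpow_add hp0, Real.rpow_one]
  push_cast
  have : ∏ i ∈ Finset.range k, (r + ((i : ℝ) + 1)) = ∏ i ∈ Finset.range k, (r + 1 + (i : ℝ)) :=
    Finset.prod_congr rfl fun i _ => by ring
  rw [this, add_zero]
  field_simp

/-- This is the binomial series of (1 - x)^(-r) at x = 1 - p, multiplied by p^r. -/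
lemma hasSum_nbPmf {r p : ℝ} (hp0 : 0 < p) (hp1 : p < 1) : HasSum (nbPmf r p) 1 := by
  have h := (Real.one_div_one_sub_rpow_hasFPowerSeriesOnBall_zero r).hasSum (y := 1 - p) (by
    rw [← ENNReal.ofReal_one, Metric.eball_ofReal]
    simp [abs_of_pos (show 0 < 1 - p by linarith), hp0])
  have h2 := h.mul_left (p ^ r)
  have e : p ^ r * (1 / (1 - (0 + (1 - p))) ^ r) = 1 := by
    rw [zero_add, sub_sub_cancel]
    have := Real.rpow_pos_of_pos hp0 r
    field_simp
  rw [e] at h2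
  refine h2.congr_fun fun k => ?_
  simp only [nbPmf, FormalMultilinearSeries.ofScalars_apply_eq, choose_eq_prod_div, smul_eq_mul]
  ring

/-- Size biasing: k π_k is the mean times the weight at k - 1 for parameter r + 1, so moments reduce
to lower moments for r + 1. -/
lemma hasSum_nbPmf_mul_nat {r p : ℝ} (hp0 : 0 < p) (hp1 : p < 1) :
    HasSum (fun k : ℕ => nbPmf r p k * k) (r * (1 - p) / p) := by
  rw [← hasSum_nat_add_iff' 1]
  have h := (hasSum_nbPmf (r := r + 1) hp0 hp1).mul_left (r * (1 - p) / p)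
  simp only [Finset.range_one, Finset.sum_singleton, Nat.cast_zero, mul_zero, sub_zero]
  rw [mul_one] at h
  refine h.congr_fun fun k => ?_
  rw [← nbPmf_succ_shift hp0]
  push_cast; ring

lemma hasSum_nbPmf_mul_sq {r p : ℝ} (hp0 : 0 < p) (hp1 : p < 1) :
    HasSum (fun k : ℕ => nbPmf r p k * (k : ℝ) ^ 2)
      (r * (1 - p) / p * ((r + 1) * (1 - p) / p + 1)) := by
  rw [← hasSum_nat_add_iff' 1]
  have h := ((hasSum_nbPmf_mul_nat (r := r + 1) hp0 hp1).add
    (hasSum_nbPmf (r := r + 1) hp0 hp1)).mul_left (r * (1 - p) / p)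
  simp only [Finset.range_one, Finset.sum_singleton, Nat.cast_zero, ne_eq, OfNat.ofNat_ne_zero,
    not_false_eq_true, zero_pow, mul_zero, sub_zero]
  refine h.congr_fun fun k => ?_
  have := nbPmf_succ_shift (r := r) hp0 k
  push_cast
  linear_combination ((k : ℝ) + 1) * this

/-! ### Integrals against the negative binomial measure -/

lemma nbMeasure_eq (r p : ℝ) : nbMeasure r p =
    Measure.sum fun k : ℕ => ENNReal.ofReal (nbPmf r p k) • Measure.dirac k := by
  simp only [nbMeasure, nbPmf, choose_eq_prod_div]

lemma integral_nbMeasure {r p : ℝ} (hr : 0 < r) (hp0 : 0 < p) (hp1 : p < 1) (u : ℕ → ℝ) :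
    ∫ k, u k ∂(nbMeasure r p) = ∑' k, nbPmf r p k * u k := by
  rw [nbMeasure_eq, integral_sum_dirac fun _ => ENNReal.ofReal_ne_top]
  simp [ENNReal.toReal_ofReal (nbPmf_pos hr hp0 hp1 _).le]

lemma mean_nbMeasure {r p : ℝ} (hr : 0 < r) (hp0 : 0 < p) (hp1 : p < 1) :
    mean (nbMeasure r p) id = r * (1 - p) / p := by
  rw [mean, integral_nbMeasure hr hp0 hp1 fun k => ((id k : ℕ) : ℝ)]
  exact (hasSum_nbPmf_mul_nat hp0 hp1).tsum_eq

lemma var_nbMeasure {r p : ℝ} (hr : 0 < r) (hp0 : 0 < p) (hp1 : p < 1) :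
    var (nbMeasure r p) id = r * (1 - p) / p ^ 2 := by
  have hm := mean_nbMeasure hr hp0 hp1
  rw [mean] at hm
  rw [var, variance_eq_integral (Measurable.of_discrete.aemeasurable), hm,
    integral_nbMeasure hr hp0 hp1 fun k => (((id k : ℕ) : ℝ) - r * (1 - p) / p) ^ 2]
  have h := ((hasSum_nbPmf_mul_sq (r := r) hp0 hp1).add
    ((hasSum_nbPmf_mul_nat (r := r) hp0 hp1).mul_left (-2 * (r * (1 - p) / p)))).add
    ((hasSum_nbPmf (r := r) hp0 hp1).mul_left ((r * (1 - p) / p) ^ 2))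
  rw [HasSum.tsum_eq (h.congr_fun fun k => ?_)]
  · field_simp
    ring
  · simp only [id]
    ring

lemma callFn_nonneg (z : ℝ) (k : ℕ) : 0 ≤ callFn z k := le_max_right _ _

lemma hasSum_nbCall {r p z : ℝ} (hr : 0 < r) (hp0 : 0 < p) (hp1 : p < 1) (hz : 0 ≤ z) :
    HasSum (fun k => nbPmf r p k * callFn z k) (nbCall r p z) := by
  rw [nbCall, integral_nbMeasure hr hp0 hp1]
  refine (Summable.of_nonneg_of_le (fun k => ?_) (fun k => ?_)
    (hasSum_nbPmf_mul_nat (r := r) hp0 hp1).summable).hasSum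
  · exact mul_nonneg (nbPmf_pos hr hp0 hp1 k).le (callFn_nonneg z k)
  · refine mul_le_mul_of_nonneg_left ?_ (nbPmf_pos hr hp0 hp1 k).le
    exact max_le (by linarith) (Nat.cast_nonneg k)

lemma nbCall_nonneg {r p z : ℝ} : 0 ≤ nbCall r p z :=
  integral_nonneg fun k => callFn_nonneg z k

lemma nbCall_le_mean {r p z : ℝ} (hr : 0 < r) (hp0 : 0 < p) (hp1 : p < 1) (hz : 0 ≤ z) :
    nbCall r p z ≤ r * (1 - p) / p := by
  refine hasSum_le (fun k => ?_) (hasSum_nbCall hr hp0 hp1 hz) (hasSum_nbPmf_mul_nat hp0 hp1)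
  refine mul_le_mul_of_nonneg_left ?_ (nbPmf_pos hr hp0 hp1 k).le
  exact max_le (by linarith) (Nat.cast_nonneg k)

lemma mean_sub_le_nbCall {r p z : ℝ} (hr : 0 < r) (hp0 : 0 < p) (hp1 : p < 1) (hz : 0 ≤ z) :
    r * (1 - p) / p - z ≤ nbCall r p z := by
  have h := (hasSum_nbPmf_mul_nat (r := r) hp0 hp1).sub
    ((hasSum_nbPmf (r := r) hp0 hp1).mul_right z)
  rw [one_mul] at h
  refine hasSum_le (fun k => ?_) h (hasSum_nbCall hr hp0 hp1 hz)
  rw [← mul_sub]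
  exact mul_le_mul_of_nonneg_left (le_max_left _ _) (nbPmf_pos hr hp0 hp1 k).le

/-! ### Tails -/

/-- `ℙ(N < k)` for a negative binomial `N`. -/
noncomputable def nbCdf (r p : ℝ) (k : ℕ) : ℝ := ∑ j ∈ Finset.range k, nbPmf r p j

lemma nbCdf_nonneg {r p : ℝ} (hr : 0 < r) (hp0 : 0 < p) (hp1 : p < 1) (k : ℕ) :
    0 ≤ nbCdf r p k := Finset.sum_nonneg fun j _ => (nbPmf_pos hr hp0 hp1 j).le

lemma hasSum_nbPmf_tail {r p : ℝ} (hp0 : 0 < p) (hp1 : p < 1) (k : ℕ) :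
    HasSum (fun m => nbPmf r p (m + k)) (1 - nbCdf r p k) :=
  (hasSum_nat_add_iff' k).2 (hasSum_nbPmf hp0 hp1)

lemma nbCdf_le_one {r p : ℝ} (hr : 0 < r) (hp0 : 0 < p) (hp1 : p < 1) (k : ℕ) :
    nbCdf r p k ≤ 1 :=
  sub_nonneg.1 ((hasSum_nbPmf_tail hp0 hp1 k).nonneg fun _ => (nbPmf_pos hr hp0 hp1 _).le)

/-- The sum telescopes, because the ratio recursion says that (j+1) π_{j+1} - j π_j = π_j (r q - p
j). It makes partial sums of linear functions explicit. -/
lemma sum_range_nbPmf_mul_drift {p : ℝ} (r : ℝ) (k : ℕ) :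
    ∑ j ∈ Finset.range k, nbPmf r p j * (r * (1 - p) - p * j) = k * nbPmf r p k := by
  induction k with
  | zero => simp
  | succ k ih =>
    rw [Finset.sum_range_succ, ih]
    push_cast
    rw [nbPmf_succ]
    ring

lemma hasSum_nbPmf_mul_drift_tail {r p : ℝ} (hp0 : 0 < p) (hp1 : p < 1) (k : ℕ) :
    HasSum (fun m => nbPmf r p (m + k) * (p * ((m + k : ℕ) : ℝ) - r * (1 - p)))
      (k * nbPmf r p k) := by
  have h := ((hasSum_nbPmf_mul_nat (r := r) hp0 hp1).mul_left p).sub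
    ((hasSum_nbPmf (r := r) hp0 hp1).mul_right (r * (1 - p)))
  have h2 := (hasSum_nat_add_iff' k).2 h
  have e : p * (r * (1 - p) / p) - 1 * (r * (1 - p)) -
      ∑ j ∈ Finset.range k, (p * (nbPmf r p j * j) - nbPmf r p j * (r * (1 - p))) =
      k * nbPmf r p k := by
    rw [← sum_range_nbPmf_mul_drift, mul_div_cancel₀ _ hp0.ne', one_mul, sub_self, zero_sub,
      ← Finset.sum_neg_distrib]
    exact Finset.sum_congr rfl fun j _ => by ring
  rw [e] at h2
  exact h2.congr_fun fun m => by ring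

/-- For r > 1 the ratio π_{j+1}/π_j = q (r+j)/(j+1) is at least q, so the tail at k + 1 is at least
q times the tail at k, and π_k is the difference of the two tails. -/
lemma nbPmf_le_tail {r p : ℝ} (hr : 1 < r) (hp0 : 0 < p) (hp1 : p < 1) (k : ℕ) :
    nbPmf r p k ≤ p * (1 - nbCdf r p k) := by
  have h0 := hasSum_nbPmf_tail (r := r) hp0 hp1 k
  have h1 := hasSum_nbPmf_tail (r := r) hp0 hp1 (k + 1)
  have h2 : (1 - p) * (1 - nbCdf r p k) ≤ 1 - nbCdf r p (k + 1) := by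
    refine hasSum_le (fun m => ?_) (h0.mul_left (1 - p)) h1
    have h3 := nbPmf_succ r p (m + k)
    have h4 := nbPmf_pos (by linarith) hp0 hp1 (r := r) (m + k)
    rw [show m + (k + 1) = m + k + 1 by ring]
    have h5 : (0 : ℝ) < ((m + k : ℕ) : ℝ) + 1 := by positivity
    rw [← mul_le_mul_iff_right₀ h5, h3]
    have h6 : 0 ≤ (1 - p) * nbPmf r p (m + k) := mul_nonneg (by linarith) h4.le
    nlinarith
  have h3 : nbCdf r p (k + 1) = nbCdf r p k + nbPmf r p k := Finset.sum_range_succ _ _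
  linarith

/-- In the tail identity from k + 1 on, each factor p j - r q exceeds its value at j = k. This and
the mirror statement for the lower sum fix the sign of the increments of g. -/
lemma drift_mul_tail_le {r p : ℝ} (hr : 0 < r) (hp0 : 0 < p) (hp1 : p < 1) (k : ℕ) :
    (p * k - r * (1 - p)) * (1 - nbCdf r p (k + 1)) ≤ (k + 1) * nbPmf r p (k + 1) := by
  have h1 := hasSum_nbPmf_mul_drift_tail (r := r) hp0 hp1 (k + 1)
  have h2 := (hasSum_nbPmf_tail (r := r) hp0 hp1 (k + 1)).mul_left (p * k - r * (1 - p))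
  push_cast at h1
  refine hasSum_le (fun m => ?_) h2 h1
  rw [mul_comm]
  refine mul_le_mul_of_nonneg_left ?_ (nbPmf_pos hr hp0 hp1 _).le
  have : 0 ≤ p * ((m : ℝ) + 1) := by positivity
  linarith

lemma neg_drift_mul_cdf_le {r p : ℝ} (hr : 0 < r) (hp0 : 0 < p) (hp1 : p < 1) (k : ℕ) :
    (r * (1 - p) - p * k) * nbCdf r p (k + 1) ≤ (k + 1) * nbPmf r p (k + 1) := by
  have h := sum_range_nbPmf_mul_drift (p := p) r (k + 1)
  push_cast at h
  rw [← h, nbCdf, Finset.mul_sum]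
  refine Finset.sum_le_sum fun j hj => ?_
  rw [mul_comm]
  refine mul_le_mul_of_nonneg_left ?_ (nbPmf_pos hr hp0 hp1 _).le
  have : (j : ℝ) ≤ k := by exact_mod_cast Nat.lt_succ_iff.1 (Finset.mem_range.1 hj)
  nlinarith

/-! ### The solution of the Stein equation -/

/-- The products, factorials and powers of q combine to π_{k+m} / (k π_k). -/
lemma steinTerm_eq {r p z : ℝ} (hr : 0 < r) (hp0 : 0 < p) (hp1 : p < 1) {k : ℕ} (hk : 1 ≤ k)
    (m : ℕ) : steinTerm r p z k (k + m) =
      (k * nbPmf r p k)⁻¹ * (nbPmf r p (m + k) * (callFn z (m + k) - nbCall r p z)) := by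
  have h2 : ∏ i ∈ Finset.range k, (r + i) ≠ 0 := Finset.prod_ne_zero_iff.2 fun i _ => by positivity
  have h3 : 1 - p ≠ 0 := by linarith
  have h4 : p ^ r ≠ 0 := (Real.rpow_pos_of_pos hp0 r).ne'
  have h5 : (k : ℝ) ≠ 0 := by positivity
  have h6 : (k.factorial : ℝ) = k * (k - 1).factorial := by
    exact_mod_cast (Nat.mul_factorial_pred (by omega)).symm
  have h7 : ((k - 1).factorial : ℝ) ≠ 0 := by positivity
  rw [steinTerm, nbPmf, nbPmf, h6, add_comm m k, Nat.add_sub_cancel_left, pow_add]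
  field_simp

/-- The centred call function has π-mean zero, so its tail sum is minus its finite lower sum. -/
lemma hasSum_steinTerm {r p z : ℝ} (hr : 0 < r) (hp0 : 0 < p) (hp1 : p < 1) (hz : 0 ≤ z) {k : ℕ}
    (hk : 1 ≤ k) : HasSum (fun m => steinTerm r p z k (k + m))
      ((k * nbPmf r p k)⁻¹ *
        ∑ j ∈ Finset.range k, nbPmf r p j * (nbCall r p z - callFn z j)) := by
  have h := (hasSum_nbCall hr hp0 hp1 hz).sub
    ((hasSum_nbPmf (r := r) hp0 hp1).mul_right (nbCall r p z))
  have h2 := ((hasSum_nat_add_iff' k).2 h).mul_left ((k * nbPmf r p k)⁻¹)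
  have e : nbCall r p z - 1 * nbCall r p z - ∑ j ∈ Finset.range k,
      (nbPmf r p j * callFn z j - nbPmf r p j * nbCall r p z) =
      ∑ j ∈ Finset.range k, nbPmf r p j * (nbCall r p z - callFn z j) := by
    rw [one_mul, sub_self, zero_sub, ← Finset.sum_neg_distrib]
    exact Finset.sum_congr rfl fun j _ => by ring
  rw [e] at h2
  refine h2.congr_fun fun m => ?_
  rw [steinTerm_eq hr hp0 hp1 hk, mul_sub]

lemma mul_steinSol {r p z : ℝ} (hr : 0 < r) (hp0 : 0 < p) (hp1 : p < 1) (hz : 0 ≤ z) (k : ℕ) :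
    k * nbPmf r p k * -steinSol r p z k =
      ∑ j ∈ Finset.range k, nbPmf r p j * (nbCall r p z - callFn z j) := by
  rcases Nat.eq_zero_or_pos k with rfl | hk
  · simp
  · rw [steinSol, if_neg hk.ne', neg_neg, (hasSum_steinTerm hr hp0 hp1 hz hk).tsum_eq,
      mul_inv_cancel_left₀ (mul_pos (by exact_mod_cast hk) (nbPmf_pos hr hp0 hp1 k)).ne']

/-- `steinSol` solves the Stein equation. -/
lemma steinOp_steinSol {r p z : ℝ} (hr : 0 < r) (hp0 : 0 < p) (hp1 : p < 1) (hz : 0 ≤ z) (k : ℕ) :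
    steinOp r p (steinSol r p z) k = callFn z k - nbCall r p z := by
  have h1 := mul_steinSol hr hp0 hp1 hz (k + 1)
  have h0 := mul_steinSol hr hp0 hp1 hz k
  rw [Finset.sum_range_succ, ← h0] at h1
  push_cast at h1
  rw [nbPmf_succ] at h1
  refine mul_left_cancel₀ (nbPmf_pos hr hp0 hp1 k).ne' ?_
  rw [steinOp]
  linear_combination -h1

lemma mul_steinSol_of_le {r p z : ℝ} (hr : 0 < r) (hp0 : 0 < p) (hp1 : p < 1) (hz : 0 ≤ z) {k : ℕ}
    (hk : (k : ℝ) ≤ z + 1) :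
    k * nbPmf r p k * -steinSol r p z k = nbCall r p z * nbCdf r p k := by
  rw [mul_steinSol hr hp0 hp1 hz, nbCdf, Finset.mul_sum]
  refine Finset.sum_congr rfl fun j hj => ?_
  have : (j : ℝ) + 1 ≤ k := by exact_mod_cast Finset.mem_range.1 hj
  rw [callFn, max_eq_right (by linarith)]
  ring

/-- Above z the call function is linear, so the tail form of the solution is evaluated by the drift
identity. The coefficient C + z - 𝔼N of the tail probability is nonnegative and at most z. -/
lemma mul_steinSol_of_ge {r p z : ℝ} (hr : 0 < r) (hp0 : 0 < p) (hp1 : p < 1) (hz : 0 ≤ z) {k : ℕ}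
    (hk : z ≤ k) :
    k * nbPmf r p k * -steinSol r p z k = k * nbPmf r p k / p -
      (nbCall r p z + z - r * (1 - p) / p) * (1 - nbCdf r p k) := by
  have h := (hasSum_nbCall hr hp0 hp1 hz).sub
    ((hasSum_nbPmf (r := r) hp0 hp1).mul_right (nbCall r p z))
  have h2 := (hasSum_nat_add_iff' k).2 h
  have h3 := ((hasSum_nbPmf_mul_drift_tail (r := r) hp0 hp1 k).mul_left p⁻¹).sub
    ((hasSum_nbPmf_tail (r := r) hp0 hp1 k).mul_left (nbCall r p z + z - r * (1 - p) / p))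
  have e : nbCall r p z - 1 * nbCall r p z - ∑ j ∈ Finset.range k,
      (nbPmf r p j * callFn z j - nbPmf r p j * nbCall r p z) =
      k * nbPmf r p k * -steinSol r p z k := by
    rw [mul_steinSol hr hp0 hp1 hz, one_mul, sub_self, zero_sub, ← Finset.sum_neg_distrib]
    exact Finset.sum_congr rfl fun j _ => by ring
  rw [e] at h2
  rw [h2.unique (h3.congr_fun fun m => ?_)]
  · ring
  · have : z ≤ ((m + k : ℕ) : ℝ) := by push_cast; linarith [Nat.cast_nonneg (α := ℝ) m]
    rw [callFn, max_eq_left (by linarith)]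
    field_simp
    ring

/-! ### Monotonicity of the solution and bounds on its increments -/

section SteinFactors

variable {r p z : ℝ}

lemma mul_steinSol_sub (hr : 0 < r) (hp0 : 0 < p) (hp1 : p < 1) (hz : 0 ≤ z) (k : ℕ) :
    k * (steinSol r p z k - steinSol r p z (k + 1)) =
      (p * k - r * (1 - p)) * -steinSol r p z (k + 1) - callFn z k + nbCall r p z := by
  have h := steinOp_steinSol hr hp0 hp1 hz k
  rw [steinOp] at h
  linear_combination -h

lemma mul_steinSol_sub_of_ge (hr : 0 < r) (hp0 : 0 < p) (hp1 : p < 1) (hz : 0 ≤ z) {k : ℕ}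
    (hk : z ≤ k) :
    ((k : ℝ) + 1) * nbPmf r p (k + 1) * (k * (steinSol r p z k - steinSol r p z (k + 1))) =
      (nbCall r p z + z - r * (1 - p) / p) * (((k : ℝ) + 1) * nbPmf r p (k + 1) -
        (p * k - r * (1 - p)) * (1 - nbCdf r p (k + 1))) := by
  have h := mul_steinSol_of_ge hr hp0 hp1 hz (k := k + 1) (by push_cast; linarith)
  push_cast at h
  rw [mul_steinSol_sub hr hp0 hp1 hz, callFn, max_eq_left (by linarith)]
  have e : (p * k - r * (1 - p)) / p = k - r * (1 - p) / p := by field_simp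
  linear_combination (p * k - r * (1 - p)) * h + (((k : ℝ) + 1) * nbPmf r p (k + 1)) * e

/-- After multiplication by k (k+1) π_{k+1}, the decrement is a nonnegative constant times the slack
of `drift_mul_tail_le` if k ≥ z, or of `neg_drift_mul_cdf_le` if k ≤ z. -/
lemma steinSol_succ_le (hr : 0 < r) (hp0 : 0 < p) (hp1 : p < 1) (hz : 0 ≤ z) {k : ℕ}
    (hk : 1 ≤ k) : steinSol r p z (k + 1) ≤ steinSol r p z k := by
  have hG : 0 < ((k : ℝ) + 1) * nbPmf r p (k + 1) := mul_pos (by positivity) (nbPmf_pos hr hp0 hp1 _)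
  have hk0 : (0 : ℝ) < k := by exact_mod_cast hk
  suffices 0 ≤ ((k : ℝ) + 1) * nbPmf r p (k + 1) *
      (k * (steinSol r p z k - steinSol r p z (k + 1))) from
    sub_nonneg.1 (nonneg_of_mul_nonneg_right (nonneg_of_mul_nonneg_right this hG) hk0)
  rcases le_total z k with h | h
  · rw [mul_steinSol_sub_of_ge hr hp0 hp1 hz h]
    exact mul_nonneg (by linarith [mean_sub_le_nbCall hr hp0 hp1 hz])
      (by linarith [drift_mul_tail_le hr hp0 hp1 k])
  · have h1 := mul_steinSol_of_le hr hp0 hp1 hz (k := k + 1) (by push_cast; linarith)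
    push_cast at h1
    rw [mul_steinSol_sub hr hp0 hp1 hz, callFn, max_eq_right (by linarith)]
    have h2 := mul_nonneg (nbCall_nonneg (r := r) (p := p) (z := z))
      (sub_nonneg.2 (neg_drift_mul_cdf_le hr hp0 hp1 k))
    linear_combination h2 - (p * k - r * (1 - p)) * h1

lemma antitone_steinSol_succ (hr : 0 < r) (hp0 : 0 < p) (hp1 : p < 1) (hz : 0 ≤ z) :
    Antitone fun k => steinSol r p z (k + 1) :=
  antitone_nat_of_succ_le fun _ => steinSol_succ_le hr hp0 hp1 hz (Nat.succ_pos _)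

lemma steinSol_nonpos (hr : 0 < r) (hp0 : 0 < p) (hp1 : p < 1) (hz : 0 ≤ z) (k : ℕ) :
    steinSol r p z k ≤ 0 := by
  rcases k with _ | k
  · simp [steinSol]
  · refine (antitone_steinSol_succ hr hp0 hp1 hz (Nat.zero_le k)).trans ?_
    have h := mul_steinSol_of_le hr hp0 hp1 hz (k := 1) (by push_cast; linarith)
    have h2 := mul_nonneg (nbCall_nonneg (r := r) (p := p) (z := z)) (nbCdf_nonneg hr hp0 hp1 1)
    rw [← h, Nat.cast_one, one_mul] at h2
    exact neg_nonneg.1 (nonneg_of_mul_nonneg_right h2 (nbPmf_pos hr hp0 hp1 1))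

/-- By monotonicity it suffices to bound -g at one later point beyond z, where the closed form is
1/p minus a nonnegative term. -/
lemma neg_steinSol_le (hr : 0 < r) (hp0 : 0 < p) (hp1 : p < 1) (hz : 0 ≤ z) (k : ℕ) :
    -steinSol r p z k ≤ p⁻¹ := by
  rcases k with _ | k
  · simp [steinSol, hp0.le]
  · have h := mul_steinSol_of_ge hr hp0 hp1 hz (k := max k ⌈z⌉₊ + 1) (by
      push_cast
      have := Nat.le_ceil z
      have h2 : ((⌈z⌉₊ : ℕ) : ℝ) ≤ max (k : ℝ) (⌈z⌉₊ : ℝ) := le_max_right _ _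
      linarith)
    refine (neg_le_neg (antitone_steinSol_succ hr hp0 hp1 hz (le_max_left k ⌈z⌉₊))).trans ?_
    have h2 := mul_nonneg (by linarith [mean_sub_le_nbCall hr hp0 hp1 hz] :
      0 ≤ nbCall r p z + z - r * (1 - p) / p)
      (sub_nonneg.2 (nbCdf_le_one hr hp0 hp1 (max k ⌈z⌉₊ + 1)))
    have hG : 0 < ((max k ⌈z⌉₊ + 1 : ℕ) : ℝ) * nbPmf r p (max k ⌈z⌉₊ + 1) :=
      mul_pos (by positivity) (nbPmf_pos hr hp0 hp1 _)
    refine le_of_mul_le_mul_left ?_ hG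
    rw [h, div_eq_mul_inv]
    linarith

lemma abs_steinSol_le (hr : 0 < r) (hp0 : 0 < p) (hp1 : p < 1) (hz : 0 ≤ z) (k : ℕ) :
    |steinSol r p z k| ≤ p⁻¹ := by
  rw [abs_of_nonpos (steinSol_nonpos hr hp0 hp1 hz k)]
  exact neg_steinSol_le hr hp0 hp1 hz k

lemma steinSol_sub_le_inv (hr : 0 < r) (hp0 : 0 < p) (hp1 : p < 1) (hz : 0 ≤ z) (k : ℕ) :
    steinSol r p z k - steinSol r p z (k + 1) ≤ p⁻¹ := by
  linarith [steinSol_nonpos hr hp0 hp1 hz k, neg_steinSol_le hr hp0 hp1 hz (k + 1)]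

/-- The tail bound `ℙ(N ≥ k) ≥ ℙ(N = k) / p` gives decay in the level `z`, at `k ≥ z`. -/
lemma mul_neg_steinSol_le_of_ge (hr : 1 < r) (hp0 : 0 < p) (hp1 : p < 1) (hz : 0 ≤ z) {k : ℕ}
    (hk : z ≤ k) (hk1 : (k : ℝ) ≤ z + 1) (hk0 : 1 ≤ k) :
    z * -steinSol r p z k ≤ (1 + r * (1 - p) / p) / p := by
  have hr0 : 0 < r := by linarith
  have hk0' : (0 : ℝ) < k := by exact_mod_cast hk0
  have hG : 0 < (k : ℝ) * nbPmf r p k := mul_pos hk0' (nbPmf_pos hr0 hp0 hp1 k)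
  have hh0 := neg_nonneg.2 (steinSol_nonpos hr0 hp0 hp1 hz k)
  have hh1 := neg_steinSol_le hr0 hp0 hp1 hz k
  have hE : 0 ≤ r * (1 - p) / p := div_nonneg (mul_nonneg hr0.le (by linarith)) hp0.le
  -- Below the mean the crude bound 1/p is enough. Above it, the tail bound cancels all of k except
  -- k - z + 𝔼N, which is at most 1 + 𝔼N because k ≤ z + 1.
  rcases le_total z (r * (1 - p) / p) with hzE | hzE
  · calc z * -steinSol r p z k ≤ (1 + r * (1 - p) / p) * p⁻¹ :=
        mul_le_mul (by linarith) hh1 hh0 (by linarith)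
      _ = _ := (div_eq_mul_inv _ _).symm
  · have h := mul_steinSol_of_ge hr0 hp0 hp1 hz hk
    have hT := nbPmf_le_tail hr hp0 hp1 k
    have hC := nbCall_nonneg (r := r) (p := p) (z := z)
    have hT0 := sub_nonneg.2 (nbCdf_le_one hr0 hp0 hp1 k)
    have h1 : (z - r * (1 - p) / p) * nbPmf r p k ≤
        p * ((nbCall r p z + z - r * (1 - p) / p) * (1 - nbCdf r p k)) := by
      calc (z - r * (1 - p) / p) * nbPmf r p k
          ≤ (nbCall r p z + z - r * (1 - p) / p) * (p * (1 - nbCdf r p k)) :=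
            mul_le_mul (by linarith) hT (nbPmf_pos hr0 hp0 hp1 k).le (by linarith)
        _ = _ := by ring
    have h2 : p * (k * nbPmf r p k * -steinSol r p z k) =
        k * nbPmf r p k - p * ((nbCall r p z + z - r * (1 - p) / p) * (1 - nbCdf r p k)) := by
      rw [h]; field_simp
    have h3 : nbPmf r p k * (p * (k * -steinSol r p z k)) ≤
        nbPmf r p k * (1 + r * (1 - p) / p) := by
      have := mul_nonneg (nbPmf_pos hr0 hp0 hp1 k).le (by linarith : 0 ≤ z + 1 - k)
      nlinarith
    have h4 := le_of_mul_le_mul_left h3 (nbPmf_pos hr0 hp0 hp1 k)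
    rw [le_div_iff₀ hp0]
    have := mul_le_mul_of_nonneg_right hk (mul_nonneg hh0 hp0.le)
    linarith

lemma mul_steinSol_sub_le (hr : 1 < r) (hp0 : 0 < p) (hp1 : p < 1) (hz : 0 ≤ z) {k : ℕ}
    (hk : 1 ≤ k) :
    z * (steinSol r p z k - steinSol r p z (k + 1)) ≤ (r + 1) / p ^ 2 := by
  have hr0 : 0 < r := by linarith
  have hk0 : (0 : ℝ) < k := by exact_mod_cast hk
  have hE : 0 ≤ r * (1 - p) / p := div_nonneg (mul_nonneg hr0.le (by linarith)) hp0.le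
  have hEp : (1 + r * (1 - p) / p) / p ≤ (r + 1) / p ^ 2 := by
    rw [div_le_div_iff₀ hp0 (by positivity)]
    have : r * (1 - p) / p * p = r * (1 - p) := div_mul_cancel₀ _ hp0.ne'
    nlinarith [mul_pos hr0 hp0]
  have hE1 : 1 + r * (1 - p) / p ≤ (1 + r * (1 - p) / p) / p := by
    rw [le_div_iff₀ hp0]; nlinarith
  have hd := sub_nonneg.2 (steinSol_succ_le hr0 hp0 hp1 hz hk)
  have hd1 := steinSol_sub_le_inv hr0 hp0 hp1 hz k
  rcases le_total z k with h | h
  · rcases le_total (p * k) (r * (1 - p)) with hpk | hpk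
    · have : z ≤ r * (1 - p) / p := by
        rw [le_div_iff₀ hp0]; nlinarith
      refine le_trans (mul_le_mul this hd1 hd hE) (le_trans ?_ hEp)
      rw [div_eq_mul_inv (1 + _)]
      exact mul_le_mul_of_nonneg_right (by linarith) (by positivity)
    -- Here the tail is at least π_{k+1}/p, so the bracket in the closed form is at most (1 + 𝔼N)
    -- π_{k+1}. The prefactor is at most z ≤ k, which leaves z d ≤ 1 + 𝔼N for the decrement d.
    · refine le_trans ?_ (hE1.trans hEp)
      have hP := nbPmf_pos hr0 hp0 hp1 (k + 1)
      have h1 := mul_steinSol_sub_of_ge hr0 hp0 hp1 hz h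
      have hT := nbPmf_le_tail hr hp0 hp1 (k + 1)
      have hD0 : 0 ≤ nbCall r p z + z - r * (1 - p) / p := by
        linarith [mean_sub_le_nbCall hr0 hp0 hp1 hz]
      have hD1 : nbCall r p z + z - r * (1 - p) / p ≤ z := by
        linarith [nbCall_le_mean hr0 hp0 hp1 hz]
      set d := steinSol r p z k - steinSol r p z (k + 1)
      set P := nbPmf r p (k + 1)
      set D := nbCall r p z + z - r * (1 - p) / p
      set T := 1 - nbCdf r p (k + 1)
      have h2 : (k - r * (1 - p) / p) * P ≤ (p * k - r * (1 - p)) * T := by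
        have e : p * k - r * (1 - p) = p * (k - r * (1 - p) / p) := by field_simp
        have : 0 ≤ k - r * (1 - p) / p := by
          rw [sub_nonneg, div_le_iff₀ hp0]; linarith
        rw [e]
        nlinarith
      have h3 : P * (((k : ℝ) + 1) * (k * d)) ≤ P * (z * (1 + r * (1 - p) / p)) := by
        calc P * (((k : ℝ) + 1) * (k * d)) = D * (((k : ℝ) + 1) * P - (p * k - r * (1 - p)) * T) := by
              rw [← h1]; ring
          _ ≤ D * (P * (1 + r * (1 - p) / p)) :=
              mul_le_mul_of_nonneg_left (by linarith) hD0
          _ ≤ z * (P * (1 + r * (1 - p) / p)) :=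
              mul_le_mul_of_nonneg_right hD1 (mul_nonneg hP.le (by linarith))
          _ = _ := by ring
      have h4 := le_of_mul_le_mul_left h3 hP
      refine le_of_mul_le_mul_left ?_ (by positivity : (0 : ℝ) < k)
      calc (k : ℝ) * (z * d) ≤ ((k : ℝ) + 1) * (k * d) := by
            nlinarith [mul_nonneg hk0.le hd]
        _ ≤ z * (1 + r * (1 - p) / p) := h4
        _ ≤ k * (1 + r * (1 - p) / p) := mul_le_mul_of_nonneg_right h (by linarith)
  · refine le_trans ?_ hEp
    have hfl : k ≤ ⌊z⌋₊ := Nat.le_floor h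
    -- Below z the decrement is at most -g(k+1), hence at most -g at ⌊z⌋ + 1, an integer in [z, z+1]
    -- that is not smaller than k + 1.
    have h1 := mul_neg_steinSol_le_of_ge hr hp0 hp1 hz (k := ⌊z⌋₊ + 1)
      (by push_cast; exact (Nat.lt_floor_add_one z).le)
      (by push_cast; linarith [Nat.floor_le hz]) (Nat.succ_pos _)
    refine le_trans (mul_le_mul_of_nonneg_left ?_ hz) h1
    have h2 := antitone_steinSol_succ hr0 hp0 hp1 hz hfl
    have h3 := steinSol_nonpos hr0 hp0 hp1 hz k
    simp only at h2
    linarith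

lemma inv_le_uniform_factor (hr : 1 < r) (hp0 : 0 < p) (hp1 : p < 1) :
    p⁻¹ ≤ 2 * p ^ (-(r + 1)) - p⁻¹ := by
  have : p ^ (-1 : ℝ) ≤ p ^ (-(r + 1)) :=
    Real.rpow_le_rpow_of_exponent_ge hp0 hp1.le (by linarith)
  rw [Real.rpow_neg_one] at this
  linarith

/-- Since q⁻¹ ≥ 1 and p^(-(r+2)) ≥ p^(-2), the bracket in ϑ is at least 2 p^(-2) - p^(-2). -/
lemma div_le_theta (hr : 1 < r) (hp0 : 0 < p) (hp1 : p < 1) (hz : 0 < z) :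
    (r + 1) / p ^ 2 / z ≤ theta r p z := by
  have h1 : p ^ (-2 : ℝ) ≤ p ^ (-(r + 2)) :=
    Real.rpow_le_rpow_of_exponent_ge hp0 hp1.le (by linarith)
  have h2 : p ^ (-2 : ℝ) = (p ^ 2)⁻¹ := by
    rw [Real.rpow_neg hp0.le]; norm_cast
  have h3 : 1 ≤ (1 - p)⁻¹ := (one_le_inv₀ (by linarith)).2 (by linarith)
  have h4 : 0 < p ^ (-2 : ℝ) := Real.rpow_pos_of_pos hp0 _
  have e : (r + 1) / p ^ 2 / z = (r + 1) / z * p ^ (-2 : ℝ) := by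
    rw [h2]; field_simp
  rw [e, theta]
  refine mul_le_mul_of_nonneg_left ?_ (div_nonneg (by linarith) hz.le)
  nlinarith

lemma steinSol_sub_le_uniform (hr : 1 < r) (hp0 : 0 < p) (hp1 : p < 1) (hz : 0 ≤ z) (k : ℕ) :
    steinSol r p z k - steinSol r p z (k + 1) ≤ 2 * p ^ (-(r + 1)) - p⁻¹ :=
  (steinSol_sub_le_inv (by linarith) hp0 hp1 hz k).trans (inv_le_uniform_factor hr hp0 hp1)

lemma steinSol_sub_le_theta (hr : 1 < r) (hp0 : 0 < p) (hp1 : p < 1) (hz : 0 < z) {k : ℕ}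
    (hk : 1 ≤ k) : steinSol r p z k - steinSol r p z (k + 1) ≤ theta r p z := by
  refine le_trans ?_ (div_le_theta hr hp0 hp1 hz)
  rw [le_div_iff₀ hz, mul_comm]
  exact mul_steinSol_sub_le hr hp0 hp1 hz.le hk

end SteinFactors

/-! ### Trigonometric kernels and Kanter's bound -/

/-- The kernel `∑_{1 - d ≤ s ≤ d} cos (s t)`. -/
noncomputable def cosKernel (d : ℕ) (t : ℝ) : ℝ :=
  ∑ i ∈ Finset.range d, (Real.cos (i * t) + Real.cos ((i + 1) * t))

lemma continuous_cosKernel (d : ℕ) : Continuous (cosKernel d) := by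
  unfold cosKernel; fun_prop

/-- Multiplication by cos t is one ±1 step of the walk on the Fourier side. Since the kernel
vanishes for d = 0, this is the recursion with absorption at 0. -/
lemma cos_mul_cosKernel_succ (d : ℕ) (t : ℝ) :
    Real.cos t * cosKernel (d + 1) t = (cosKernel (d + 2) t + cosKernel d t) / 2 := by
  induction d with
  | zero =>
    simp only [cosKernel, Finset.sum_range_succ, Finset.sum_range_zero, Nat.cast_zero, zero_mul,
      Real.cos_zero, Nat.cast_one]
    rw [show (1 + 1 : ℝ) * t = 2 * t by ring, Real.cos_two_mul]
    ring_nf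
  | succ d ih =>
    have h1 : ∀ n, cosKernel (n + 1) t =
        cosKernel n t + (Real.cos (n * t) + Real.cos ((n + 1) * t)) := fun n =>
      Finset.sum_range_succ _ _
    have h2 : ∀ x : ℝ, Real.cos t * Real.cos (x * t) =
        (Real.cos ((x + 1) * t) + Real.cos ((x - 1) * t)) / 2 := fun x => by
      rw [add_mul, sub_mul, one_mul, Real.cos_add, Real.cos_sub]; ring
    rw [h1 (d + 1), mul_add, mul_add, ih, h2, h2, h1 (d + 2), h1 d]
    push_cast
    rw [show (d : ℝ) + 1 - 1 = d by ring, show (d : ℝ) + 1 + 1 - 1 = d + 1 by ring,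
      show (d : ℝ) + 1 + 1 = d + 2 by ring]
    ring

lemma integral_cos_nat_mul {n : ℕ} (hn : n ≠ 0) : ∫ t in (0 : ℝ)..Real.pi, Real.cos (n * t) = 0 := by
  rw [intervalIntegral.integral_comp_mul_left _ (by exact_mod_cast hn), integral_cos]
  simp [Real.sin_nat_mul_pi]

lemma integral_cosKernel_succ (d : ℕ) :
    ∫ t in (0 : ℝ)..Real.pi, cosKernel (d + 1) t = Real.pi := by
  have hc : ∀ x : ℝ, IntervalIntegrable (fun t => Real.cos (x * t)) volume 0 Real.pi := fun x =>
    (by fun_prop : Continuous fun t : ℝ => Real.cos (x * t)).intervalIntegrable _ _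
  unfold cosKernel
  rw [intervalIntegral.integral_finsetSum fun i _ => (hc _).add (hc _),
    Finset.sum_range_succ', Finset.sum_eq_zero]
  · rw [intervalIntegral.integral_add (hc _) (hc _)]
    have := integral_cos_nat_mul (n := 1) one_ne_zero
    simp at this ⊢
  · intro i _
    rw [intervalIntegral.integral_add (hc _) (hc _)]
    have h1 := integral_cos_nat_mul (n := i + 1) (by omega)
    have h2 := integral_cos_nat_mul (n := i + 1 + 1) (by omega)
    push_cast at h1 h2 ⊢
    rw [h1, h2, add_zero]

section Walk

variable {J : Type*}

/-- `∏ (1 - δ_j + δ_j cos t)`, the characteristic function of the symmetric random walk whose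
`j`-th step vanishes with probability `1 - δ_j` and is `±1` otherwise. -/
noncomputable def walkChar (δ : J → ℝ) (s : Finset J) (t : ℝ) : ℝ :=
  ∏ j ∈ s, (1 - δ j + δ j * Real.cos t)

lemma continuous_walkChar (δ : J → ℝ) (s : Finset J) : Continuous (walkChar δ s) := by
  unfold walkChar; fun_prop

/-- The probability that the random walk with characteristic function `walkChar δ s`, started at
`d`, has not hit `0`. -/
noncomputable def survival (δ : J → ℝ) (s : Finset J) (d : ℕ) : ℝ :=
  Real.pi⁻¹ * ∫ t in (0 : ℝ)..Real.pi, walkChar δ s t * cosKernel d t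

lemma survival_zero (δ : J → ℝ) (s : Finset J) : survival δ s 0 = 0 := by
  simp [survival, cosKernel]

lemma survival_empty_succ (δ : J → ℝ) (d : ℕ) : survival δ ∅ (d + 1) = 1 := by
  simp [survival, walkChar, integral_cosKernel_succ, Real.pi_ne_zero]

lemma survival_insert_succ [DecidableEq J] (δ : J → ℝ) {s : Finset J} {a : J} (ha : a ∉ s) (d : ℕ) :
    survival δ (insert a s) (d + 1) = (1 - δ a) * survival δ s (d + 1) +
      δ a / 2 * (survival δ s (d + 2) + survival δ s d) := by
  have hi : ∀ n, IntervalIntegrable (fun t => walkChar δ s t * cosKernel n t) volume 0 Real.pi :=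
    fun n => ((continuous_walkChar δ s).mul (continuous_cosKernel n)).intervalIntegrable _ _
  have e : ∀ t, walkChar δ (insert a s) t * cosKernel (d + 1) t =
      (1 - δ a) * (walkChar δ s t * cosKernel (d + 1) t) +
      δ a / 2 * (walkChar δ s t * cosKernel (d + 2) t + walkChar δ s t * cosKernel d t) :=
    fun t => by
      rw [walkChar, Finset.prod_insert ha, ← walkChar]
      linear_combination walkChar δ s t * δ a * cos_mul_cosKernel_succ d t
  simp only [survival, e]
  rw [intervalIntegral.integral_add ((hi _).const_mul _) (((hi _).add (hi _)).const_mul _),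
    intervalIntegral.integral_const_mul, intervalIntegral.integral_const_mul,
    intervalIntegral.integral_add (hi _) (hi _)]
  ring

lemma walkChar_le_exp {δ : J → ℝ} {s : Finset J} (h0 : ∀ j ∈ s, 0 ≤ δ j)
    (h1 : ∀ j ∈ s, δ j ≤ 1 / 2) (t : ℝ) :
    walkChar δ s t ≤ Real.exp (-((∑ j ∈ s, δ j) * (1 - Real.cos t))) := by
  rw [Finset.sum_mul, ← Finset.sum_neg_distrib, Real.exp_sum]
  refine Finset.prod_le_prod (fun j hj => ?_) fun j _ => ?_
  -- Each factor is at least 1 - 2 δ_j, which is why δ_j is truncated at 1/2.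
  · nlinarith [h0 j hj, h1 j hj, Real.neg_one_le_cos t]
  · linarith [Real.add_one_le_exp (-(δ j * (1 - Real.cos t)))]

lemma cos_le_exp_neg_sin_sq {y : ℝ} : Real.cos y ≤ Real.exp (-(Real.sin y ^ 2) / 2) := by
  refine (le_abs_self _).trans (abs_le_of_sq_le_sq ?_ (Real.exp_pos _).le)
  rw [← Real.exp_nat_mul, Real.cos_sq']
  have := Real.add_one_le_exp (-(Real.sin y ^ 2))
  refine le_trans (by linarith) (this.trans (le_of_eq ?_))
  congr 1; push_cast; ring

/-- In half angles, 1 + cos t = 2 cos²(t/2). One cosine is at most exp(-sin²(t/2)/2), which raises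
the exponent from 2l to 2l + 1/2 and yields the 1/4 in the final bound. The other is the Jacobian of
x = sin(t/2), and a Gaussian integral remains. -/
lemma integral_exp_mul_one_add_cos_le {l : ℝ} (hl : 0 ≤ l) :
    ∫ t in (0 : ℝ)..Real.pi, Real.exp (-(l * (1 - Real.cos t))) * (1 + Real.cos t) ≤
      2 * Real.sqrt (Real.pi / (2 * l + 1 / 2)) := by
  set b := 2 * l + 1 / 2 with hb
  have hb0 : 0 < b := by positivity
  have h1 : ∀ t ∈ Set.Icc (0 : ℝ) Real.pi,
      Real.exp (-(l * (1 - Real.cos t))) * (1 + Real.cos t) ≤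
        4 * (Real.exp (-b * Real.sin (t / 2) ^ 2) * (Real.cos (t / 2) / 2)) := by
    intro t ht
    have hc : 0 ≤ Real.cos (t / 2) := Real.cos_nonneg_of_neg_pi_div_two_le_of_le
      (by linarith [ht.1, Real.pi_pos]) (by linarith [ht.2])
    have e : Real.cos t = 2 * Real.cos (t / 2) ^ 2 - 1 := by
      rw [← Real.cos_two_mul]; congr 1; ring
    have e2 := Real.sin_sq_add_cos_sq (t / 2)
    have e3 : Real.exp (-b * Real.sin (t / 2) ^ 2) =
        Real.exp (-(l * (1 - Real.cos t))) * Real.exp (-(Real.sin (t / 2) ^ 2) / 2) := by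
      rw [← Real.exp_add]; congr 1; rw [e, hb]
      linear_combination (-2 * l) * e2
    rw [e3, e]
    have h := mul_le_mul_of_nonneg_left (cos_le_exp_neg_sin_sq (y := t / 2))
      (mul_nonneg (Real.exp_pos (-(l * (1 - (2 * Real.cos (t / 2) ^ 2 - 1))))).le hc)
    nlinarith
  have hs : ∫ t in (0 : ℝ)..Real.pi, Real.exp (-b * Real.sin (t / 2) ^ 2) * (Real.cos (t / 2) / 2) =
      ∫ x in (0 : ℝ)..1, Real.exp (-b * x ^ 2) := by
    have hd : ∀ t ∈ Set.uIcc (0 : ℝ) Real.pi,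
        HasDerivAt (fun t : ℝ => Real.sin (t / 2)) (Real.cos (t / 2) / 2) t := fun t _ => by
      have := ((hasDerivAt_id t).div_const 2).sin
      simpa [div_eq_mul_inv] using this
    have := intervalIntegral.integral_comp_mul_deriv (g := fun x : ℝ => Real.exp (-b * x ^ 2)) hd
      (by fun_prop) (by fun_prop)
    simpa using this
  have hg : ∫ x in (0 : ℝ)..1, Real.exp (-b * x ^ 2) ≤ Real.sqrt (Real.pi / b) / 2 := by
    rw [← integral_gaussian_Ioi, intervalIntegral.integral_of_le zero_le_one]
    refine setIntegral_mono_set (integrable_exp_neg_mul_sq hb0).integrableOn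
      (Filter.Eventually.of_forall fun x => (Real.exp_pos _).le) ?_
    exact (Set.Ioc_subset_Ioi_self).eventuallyLE
  calc _ ≤ ∫ t in (0 : ℝ)..Real.pi,
        4 * (Real.exp (-b * Real.sin (t / 2) ^ 2) * (Real.cos (t / 2) / 2)) :=
        intervalIntegral.integral_mono_on Real.pi_pos.le
          ((by fun_prop : Continuous fun t : ℝ =>
            Real.exp (-(l * (1 - Real.cos t))) * (1 + Real.cos t)).intervalIntegrable _ _)
          ((by fun_prop : Continuous fun t : ℝ => 4 * (Real.exp (-b * Real.sin (t / 2) ^ 2) *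
            (Real.cos (t / 2) / 2))).intervalIntegrable _ _) h1
    _ = 4 * ∫ x in (0 : ℝ)..1, Real.exp (-b * x ^ 2) := by
        rw [intervalIntegral.integral_const_mul, hs]
    _ ≤ _ := by linarith

/-- Kanter's bound for the concentration of a symmetric random walk with small steps. -/
lemma survival_one_le {δ : J → ℝ} {s : Finset J} (h0 : ∀ j ∈ s, 0 ≤ δ j)
    (h1 : ∀ j ∈ s, δ j ≤ 1 / 2) :
    survival δ s 1 ≤ Real.sqrt (2 / Real.pi) * (1 / 4 + ∑ j ∈ s, δ j) ^ (-(1 / 2) : ℝ) := by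
  set l := ∑ j ∈ s, δ j with hl
  have hl0 : 0 ≤ l := Finset.sum_nonneg h0
  have hk : ∀ t, cosKernel 1 t = 1 + Real.cos t := fun t => by simp [cosKernel]
  have h2 : survival δ s 1 ≤ Real.pi⁻¹ * (2 * Real.sqrt (Real.pi / (2 * l + 1 / 2))) := by
    rw [survival]
    refine mul_le_mul_of_nonneg_left (le_trans ?_ (integral_exp_mul_one_add_cos_le hl0))
      (inv_nonneg.2 Real.pi_pos.le)
    refine intervalIntegral.integral_mono_on Real.pi_pos.le
      (((continuous_walkChar δ s).mul (continuous_cosKernel 1)).intervalIntegrable _ _)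
      ((by fun_prop : Continuous fun t : ℝ =>
        Real.exp (-(l * (1 - Real.cos t))) * (1 + Real.cos t)).intervalIntegrable _ _) ?_
    intro t _
    rw [hk]
    exact mul_le_mul_of_nonneg_right (walkChar_le_exp h0 h1 t) (by linarith [Real.neg_one_le_cos t])
  refine h2.trans (le_of_eq ?_)
  have hL : 0 < 1 / 4 + l := by linarith
  rw [Real.rpow_neg hL.le, ← Real.sqrt_eq_rpow, ← Real.sqrt_inv, ← Real.sqrt_mul (by positivity)]
  rw [eq_comm, Real.sqrt_eq_iff_mul_self_eq (by positivity) (by positivity)]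
  have h3 := Real.mul_self_sqrt (show 0 ≤ Real.pi / (2 * l + 1 / 2) by positivity)
  have h4 : Real.pi⁻¹ * (2 * Real.sqrt (Real.pi / (2 * l + 1 / 2))) *
      (Real.pi⁻¹ * (2 * Real.sqrt (Real.pi / (2 * l + 1 / 2)))) =
      4 * (Real.pi⁻¹) ^ 2 * (Real.pi / (2 * l + 1 / 2)) := by
    linear_combination 4 * (Real.pi⁻¹) ^ 2 * h3
  rw [h4]
  have : 2 * l + 1 / 2 = 2 * (1 / 4 + l) := by ring
  rw [this]
  have := Real.pi_pos
  field_simp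
  norm_num

end Walk

/-! ### The coupling step -/

lemma abs_hasSum_mul_le {w A : ℕ → ℝ} {W S B : ℝ} (hw : ∀ k, 0 ≤ w k) (hW : HasSum w W)
    (hA : ∀ k, |A k| ≤ B) (hS : HasSum (fun k => w k * A k) S) : |S| ≤ W * B := by
  have h := hW.mul_right B
  refine abs_le.2 ⟨?_, hasSum_le (fun k => mul_le_mul_of_nonneg_left (abs_le.1 (hA k)).2 (hw k)) hS h⟩
  refine hasSum_le (fun k => ?_) h.neg hS
  rw [← mul_neg]
  exact mul_le_mul_of_nonneg_left (abs_le.1 (hA k)).1 (hw k)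

lemma summable_mul_of_bounded {w A : ℕ → ℝ} {B : ℝ} (hw : ∀ k, 0 ≤ w k) (hW : Summable w)
    (hA : ∀ k, |A k| ≤ B) : Summable fun k => w k * A k := by
  refine Summable.of_norm_bounded (hW.mul_right B) fun k => ?_
  rw [norm_mul, Real.norm_of_nonneg (hw k)]
  exact mul_le_mul_of_nonneg_left (hA k) (hw k)

lemma summable_min_succ {γ : ℕ → ℝ} (h0 : ∀ k, 0 ≤ γ k) (hγ : Summable γ) :
    Summable fun k => min (γ k) (γ (k + 1)) :=
  Summable.of_nonneg_of_le (fun k => le_min (h0 k) (h0 _)) (fun _ => min_le_left _ _) hγ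

/-- One step of the Mineka coupling: the overlap `∑ min (γ_k, γ_{k+1})` of a law `γ` and its
translate moves the distance of two copies by `±1`. -/
lemma coupling_step {γ : ℕ → ℝ} (h0 : ∀ k, 0 ≤ γ k) (hγ : HasSum γ 1) {δ : ℝ} (hδ0 : 0 ≤ δ)
    (hδ : δ ≤ ∑' k, min (γ k) (γ (k + 1))) {ψ : ℕ → ℝ} {v : ℕ → ℝ}
    (hv : ∀ d x, |ψ (x + d) - ψ x| ≤ v d) {S S' : ℝ} (d y : ℕ)
    (hS : HasSum (fun k => γ k * ψ (y + (d + 1) + k)) S)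
    (hS' : HasSum (fun k => γ k * ψ (y + k)) S') :
    |S - S'| ≤ (1 - δ) * v (d + 1) + δ / 2 * (v (d + 2) + v d) := by
  have hsm := summable_min_succ h0 hγ.summable
  set R := ∑' k, min (γ k) (γ (k + 1)) with hR
  -- The overlap R may exceed δ; it is scaled down so that the coupled mass is exactly δ.
  obtain ⟨c, hc0, hc1, hcδ⟩ : ∃ c, 0 ≤ c ∧ c ≤ 1 ∧ c * R = δ := by
    rcases eq_or_lt_of_le (hδ0.trans hδ) with h | h
    · exact ⟨0, le_rfl, zero_le_one, by linarith⟩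
    · exact ⟨δ / R, div_nonneg hδ0 h.le, (div_le_one h).2 hδ, div_mul_cancel₀ _ h.ne'⟩
  -- With mass m_k / 2 each, the two copies use the pairs (k, k+1) and (k+1, k), so their distance d
  -- + 1 becomes d or d + 2. The rest γ - m/2 - m'/2, where m' is m shifted by one, moves both
  -- copies alike.
  let m : ℕ → ℝ := fun k => c * min (γ k) (γ (k + 1))
  let m' : ℕ → ℝ := fun k => Nat.casesOn k 0 m
  have hm0 : ∀ k, 0 ≤ m k := fun k => mul_nonneg hc0 (le_min (h0 _) (h0 _))
  have hm : HasSum m δ := by rw [← hcδ]; exact hsm.hasSum.mul_left c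
  have hmγ : ∀ k, m k ≤ γ k := fun k =>
    (mul_le_of_le_one_left (le_min (h0 _) (h0 _)) hc1).trans (min_le_left _ _)
  have hmγ' : ∀ k, m' k ≤ γ k := fun k => by
    cases k with
    | zero => exact h0 0
    | succ k => exact (mul_le_of_le_one_left (le_min (h0 _) (h0 _)) hc1).trans (min_le_right _ _)
  have hm' : HasSum m' δ := by
    rw [← hasSum_nat_add_iff' 1]
    simpa [m'] using hm
  let A : ℕ → ℝ := fun k => ψ (y + (d + 1) + k) - ψ (y + k)
  have hA : ∀ k, |A k| ≤ v (d + 1) := fun k => by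
    have := hv (d + 1) (y + k)
    rwa [show y + k + (d + 1) = y + (d + 1) + k by ring] at this
  have hBk : ∀ k, |ψ (y + (d + 1) + k) - ψ (y + (k + 1))| ≤ v d := fun k => by
    have := hv d (y + (k + 1))
    rwa [show y + (k + 1) + d = y + (d + 1) + k by ring] at this
  have hCk : ∀ k, |ψ (y + (d + 1) + (k + 1)) - ψ (y + k)| ≤ v (d + 2) := fun k => by
    have := hv (d + 2) (y + k)
    rwa [show y + k + (d + 2) = y + (d + 1) + (k + 1) by ring] at this
  have hw0 : ∀ k, 0 ≤ γ k - m k / 2 - m' k / 2 := fun k => by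
    linarith [hmγ k, hmγ' k]
  have hw := (hγ.sub (hm.div_const 2)).sub (hm'.div_const 2)
  obtain ⟨X, hX⟩ := summable_mul_of_bounded hw0 hw.summable hA
  obtain ⟨Y, hY⟩ := summable_mul_of_bounded hm0 hm.summable hBk
  obtain ⟨Z, hZ⟩ := summable_mul_of_bounded hm0 hm.summable hCk
  obtain ⟨P, hP⟩ := summable_mul_of_bounded hm0 hm.summable hA
  have hm'0 : ∀ k, 0 ≤ m' k := fun k => by
    cases k with
    | zero => exact le_rfl
    | succ k => exact hm0 k
  obtain ⟨Q, hQ⟩ := summable_mul_of_bounded hm'0 hm'.summable hA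
  have hQ' : HasSum (fun k => m k * A (k + 1)) Q := by
    have := (hasSum_nat_add_iff' 1).2 hQ
    simpa [m'] using this
  -- Exchanging the partners at k and k + 1 leaves the sum of the two differences of ψ unchanged.
  have e1 : P + Q = Y + Z := (hP.add hQ').unique ((hY.add hZ).congr_fun fun k => by
    simp only [A]; ring)
  have e2 : S - S' = X + P / 2 + Q / 2 := (hS.sub hS').unique
    (((hX.add (hP.div_const 2)).add (hQ.div_const 2)).congr_fun fun k => by simp only [A]; ring)
  have b1 := abs_hasSum_mul_le hw0 hw hA hX
  have b2 := abs_hasSum_mul_le hm0 hm hBk hY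
  have b3 := abs_hasSum_mul_le hm0 hm hCk hZ
  have e3 : S - S' = X + (Y + Z) / 2 := by rw [e2, ← e1]; ring
  rw [e3]
  rw [abs_le] at b1 b2 b3 ⊢
  constructor <;> nlinarith

/-! ### Laws on ℕ: point masses, independence and overlap -/

section Laws

variable {Ω : Type*} [MeasurableSpace Ω] {μ : Measure Ω}

lemma hasSum_integral_of_countable {ν : Measure ℕ} {u : ℕ → ℝ} (hu : Integrable u ν) :
    HasSum (fun k => ν.real {k} * u k) (∫ k, u k ∂ν) := by
  rw [← Measure.sum_smul_dirac ν] at hu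
  have h := hasSum_integral_measure hu
  rw [Measure.sum_smul_dirac] at h
  refine h.congr_fun fun k => ?_
  rw [integral_smul_measure, integral_dirac, measureReal_def, smul_eq_mul]

lemma map_real_singleton {X : Ω → ℕ} (hX : Measurable X) (k : ℕ) :
    (μ.map X).real {k} = gam μ X k := by
  rw [map_measureReal_apply hX (measurableSet_singleton k)]
  rfl

lemma gam_nonneg (X : Ω → ℕ) (k : ℕ) : 0 ≤ gam μ X k := measureReal_nonneg

lemma mean_nonneg (X : Ω → ℕ) : 0 ≤ mean μ X := integral_nonneg fun _ => Nat.cast_nonneg _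

lemma delta_le_half (X : Ω → ℕ) : delta μ X ≤ 1 / 2 := min_le_left _ _

lemma hasSum_gam_mul {X : Ω → ℕ} (hX : Measurable X) {u : ℕ → ℝ}
    (hu : Integrable (fun ω => u (X ω)) μ) :
    HasSum (fun k => gam μ X k * u k) (∫ ω, u (X ω) ∂μ) := by
  have h1 : AEStronglyMeasurable u (μ.map X) := Measurable.of_discrete.aestronglyMeasurable
  rw [← integral_map hX.aemeasurable h1]
  refine (hasSum_integral_of_countable ((integrable_map_measure h1 hX.aemeasurable).2 hu)).congr_fun
    fun k => ?_
  rw [map_real_singleton hX]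

lemma hasSum_gam [IsProbabilityMeasure μ] {X : Ω → ℕ} (hX : Measurable X) :
    HasSum (gam μ X) 1 := by
  simpa using hasSum_gam_mul (μ := μ) hX (u := fun _ => 1) (integrable_const _)

lemma hasSum_gam_mul_of_indepFun [IsProbabilityMeasure μ] {X W : Ω → ℕ} (hX : Measurable X)
    (hW : Measurable W) (hi : IndepFun X W μ) {F : ℕ → ℕ → ℝ}
    (hF : Integrable (fun ω => F (X ω) (W ω)) μ) :
    HasSum (fun k => gam μ X k * ∫ ω, F k (W ω) ∂μ) (∫ ω, F (X ω) (W ω) ∂μ) := by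
  have hm : Measurable fun ω => (X ω, W ω) := hX.prodMk hW
  have hp := (indepFun_iff_map_prod_eq_prod_map_map hX.aemeasurable hW.aemeasurable).1 hi
  have : IsProbabilityMeasure (μ.map X) := Measure.isProbabilityMeasure_map hX.aemeasurable
  have : IsProbabilityMeasure (μ.map W) := Measure.isProbabilityMeasure_map hW.aemeasurable
  have h1 : AEStronglyMeasurable (fun q : ℕ × ℕ => F q.1 q.2) (μ.map fun ω => (X ω, W ω)) :=
    Measurable.of_discrete.aestronglyMeasurable
  have h2 : Integrable (fun q : ℕ × ℕ => F q.1 q.2) ((μ.map X).prod (μ.map W)) := by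
    rw [← hp]
    exact (integrable_map_measure h1 hm.aemeasurable).2 hF
  have h3 : ∫ ω, F (X ω) (W ω) ∂μ = ∫ k, ∫ w, F k w ∂(μ.map W) ∂(μ.map X) := by
    rw [← integral_prod _ h2, ← hp, integral_map hm.aemeasurable h1]
  rw [h3]
  refine (hasSum_integral_of_countable h2.integral_prod_left).congr_fun fun k => ?_
  rw [map_real_singleton hX, integral_map hW.aemeasurable
    Measurable.of_discrete.aestronglyMeasurable]

lemma map_succ_real_singleton {X : Ω → ℕ} (hX : Measurable X) (k : ℕ) :
    (μ.map fun ω => X ω + 1).real {k + 1} = gam μ X k := by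
  rw [map_real_singleton (hX.add_const 1)]
  simp [gam]

lemma map_succ_real_singleton_zero {X : Ω → ℕ} (hX : Measurable X) :
    (μ.map fun ω => X ω + 1).real {0} = 0 := by
  rw [map_real_singleton (hX.add_const 1)]
  simp [gam]

lemma abs_measureReal_sub_le_one {ν ν' : Measure ℕ} [IsProbabilityMeasure ν]
    [IsProbabilityMeasure ν'] (A : Set ℕ) : |ν.real A - ν'.real A| ≤ 1 := by
  have h1 := measureReal_nonneg (μ := ν) (s := A)
  have h2 := measureReal_nonneg (μ := ν') (s := A)
  have h3 := measureReal_le_one (μ := ν) (s := A)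
  have h4 := measureReal_le_one (μ := ν') (s := A)
  rw [abs_le]; constructor <;> linarith

lemma dTV_le_one (ν ν' : Measure ℕ) [IsProbabilityMeasure ν] [IsProbabilityMeasure ν'] :
    dTV ν ν' ≤ 1 := ciSup_le fun A => abs_measureReal_sub_le_one A

/-- The overlap of two laws is at least `1 - d_TV`. -/
lemma one_sub_dTV_le_of_hasSum_min {ν ν' : Measure ℕ} [IsProbabilityMeasure ν]
    [IsProbabilityMeasure ν'] {R : ℝ} (hR : HasSum (fun k => min (ν.real {k}) (ν'.real {k})) R) :
    1 - dTV ν ν' ≤ R := by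
  -- On this set the minimum is ν' and off it ν, so the overlap equals 1 - (ν(A) - ν'(A)).
  let A : Set ℕ := {k | ν'.real {k} < ν.real {k}}
  have hind : ∀ (η : Measure ℕ) [IsProbabilityMeasure η] (B : Set ℕ),
      HasSum (fun k => η.real {k} * B.indicator 1 k) (η.real B) := fun η _ B => by
    have h := hasSum_integral_of_countable (ν := η) (u := B.indicator 1)
      ((integrable_const (1 : ℝ)).indicator (MeasurableSet.of_discrete (s := B)))
    rwa [integral_indicator_one MeasurableSet.of_discrete] at h
  have h := (hind ν Aᶜ).add (hind ν' A)
  have e : ν.real Aᶜ + ν'.real A = R := by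
    refine h.unique (hR.congr_fun fun k => ?_)
    by_cases hk : ν'.real {k} < ν.real {k}
    · rw [Set.indicator_of_notMem (by simpa [A] using hk), Set.indicator_of_mem (by simpa [A] using hk),
        min_eq_right hk.le]
      simp
    · rw [Set.indicator_of_mem (by simpa [A] using hk), Set.indicator_of_notMem (by simpa [A] using hk),
        min_eq_left (not_lt.1 hk)]
      simp
  rw [probReal_compl_eq_one_sub MeasurableSet.of_discrete] at e
  have hle : |ν.real A - ν'.real A| ≤ dTV ν ν' :=
    le_ciSup (f := fun A => |ν.real A - ν'.real A|)
      ⟨1, by rintro _ ⟨B, rfl⟩; exact abs_measureReal_sub_le_one B⟩ A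
  linarith [le_abs_self (ν.real A - ν'.real A)]

lemma indepFun_sum {J : Type*} {ζ : J → Ω → ℕ} (hmeas : ∀ i, Measurable (ζ i))
    (hindep : iIndepFun ζ μ) {s : Finset J} {a : J} (ha : a ∉ s) :
    IndepFun (ζ a) (fun ω => ∑ j ∈ s, ζ j ω) μ := by
  have h := (hindep.indepFun_finsetSum_of_notMem hmeas ha).symm
  convert h using 1
  ext ω
  simp

variable [IsProbabilityMeasure μ]

lemma delta_nonneg {X : Ω → ℕ} (hX : Measurable X) : 0 ≤ delta μ X := by
  have : IsProbabilityMeasure (μ.map X) := Measure.isProbabilityMeasure_map hX.aemeasurable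
  have : IsProbabilityMeasure (μ.map fun ω => X ω + 1) :=
    Measure.isProbabilityMeasure_map (hX.add_const 1).aemeasurable
  exact le_min (by norm_num) (sub_nonneg.2 (dTV_le_one _ _))

lemma delta_le_overlap {X : Ω → ℕ} (hX : Measurable X) :
    delta μ X ≤ ∑' k, min (gam μ X k) (gam μ X (k + 1)) := by
  have : IsProbabilityMeasure (μ.map X) := Measure.isProbabilityMeasure_map hX.aemeasurable
  have : IsProbabilityMeasure (μ.map fun ω => X ω + 1) :=
    Measure.isProbabilityMeasure_map (hX.add_const 1).aemeasurable
  refine (min_le_right _ _).trans (one_sub_dTV_le_of_hasSum_min ?_)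
  rw [← hasSum_nat_add_iff' 1, Finset.range_one, Finset.sum_singleton,
    map_succ_real_singleton_zero hX, min_eq_right measureReal_nonneg, sub_zero]
  refine (summable_min_succ (gam_nonneg X) (hasSum_gam hX).summable).hasSum.congr_fun fun k => ?_
  rw [map_succ_real_singleton hX, map_real_singleton hX, min_comm]

end Laws

/-! ### Translation bounds for sums of independent variables -/

section Smoothing

variable {Ω : Type*} [MeasurableSpace Ω] {μ : Measure Ω} [IsProbabilityMeasure μ]
  {J : Type*} {ζ : J → Ω → ℕ}

lemma integrable_comp_of_bounded {X : Ω → ℕ} (hX : Measurable X) {φ : ℕ → ℝ} {B : ℝ}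
    (hφ : ∀ x, |φ x| ≤ B) : Integrable (fun ω => φ (X ω)) μ :=
  Integrable.of_bound (Measurable.of_discrete.comp hX).aestronglyMeasurable B
    (Filter.Eventually.of_forall fun ω => hφ (X ω))

lemma measurable_sum_nat (hmeas : ∀ i, Measurable (ζ i)) (s : Finset J) :
    Measurable fun ω => ∑ j ∈ s, ζ j ω := Finset.measurable_sum s fun i _ => hmeas i

/-- A sum of independent variables is insensitive to translations, by the Mineka coupling. -/
lemma abs_integral_shift_sub_le (hmeas : ∀ i, Measurable (ζ i)) (hindep : iIndepFun ζ μ)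
    (s : Finset J) {φ : ℕ → ℝ} {M : ℝ} (hφ : ∀ x y, |φ x - φ y| ≤ M) (d y : ℕ) :
    |∫ ω, φ (y + d + ∑ j ∈ s, ζ j ω) ∂μ - ∫ ω, φ (y + ∑ j ∈ s, ζ j ω) ∂μ| ≤
      M * survival (fun j => delta μ (ζ j)) s d := by
  classical
  have hb : ∀ x, |φ x| ≤ |φ 0| + M := fun x => by
    have := abs_add_le (φ 0) (φ x - φ 0)
    rw [add_sub_cancel] at this
    linarith [hφ x 0]
  -- The distance d must vary: coupling one more summand leads to the distances d - 1, d and d + 1.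
  -- The resulting bound obeys the recursion of `survival`.
  induction s using Finset.induction_on generalizing d y with
  | empty =>
    rcases d with _ | d
    · simp [survival_zero]
    · simpa [survival_empty_succ] using hφ (y + (d + 1)) y
  | insert a s ha ih =>
    rcases d with _ | d
    · simp [survival_zero]
    · let ψ : ℕ → ℝ := fun x => ∫ ω, φ (x + ∑ j ∈ s, ζ j ω) ∂μ
      have key : ∀ x, HasSum (fun k => gam μ (ζ a) k * ψ (x + k))
          (∫ ω, φ (x + ∑ j ∈ insert a s, ζ j ω) ∂μ) := fun x => by
        have h := hasSum_gam_mul_of_indepFun (F := fun k w => φ (x + k + w)) (hmeas a)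
          (measurable_sum_nat hmeas s) (indepFun_sum hmeas hindep ha)
          (integrable_comp_of_bounded (φ := φ)
            ((measurable_const.add (hmeas a)).add (measurable_sum_nat hmeas s)) hb)
        simpa only [ψ, Finset.sum_insert ha, add_assoc] using h
      have h := coupling_step (gam_nonneg (ζ a)) (hasSum_gam (hmeas a)) (delta_nonneg (hmeas a))
        (delta_le_overlap (hmeas a)) (ψ := ψ) (fun d x => ih d x) d y (key _) (key y)
      refine h.trans (le_of_eq ?_)
      rw [survival_insert_succ _ ha]
      ring

variable [Fintype J] [DecidableEq J]

/-- Removing one summand from the smoothness factor costs at most the maximal `δ`. -/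
lemma survival_erase_le_smooth (hmeas : ∀ i, Measurable (ζ i)) (i : J) :
    survival (fun j => delta μ (ζ j)) (Finset.univ.erase i) 1 ≤ smooth μ ζ := by
  refine (survival_one_le (fun j _ => delta_nonneg (hmeas j)) fun j _ => delta_le_half _).trans ?_
  refine mul_le_mul_of_nonneg_left ?_ (Real.sqrt_nonneg _)
  have h1 : ∑ j ∈ Finset.univ.erase i, delta μ (ζ j) = ∑ j, delta μ (ζ j) - delta μ (ζ i) :=
    Finset.sum_erase_eq_sub (Finset.mem_univ i)
  have h2 : delta μ (ζ i) ≤ ⨆ j, delta μ (ζ j) :=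
    le_ciSup (f := fun j => delta μ (ζ j)) (Set.finite_range _).bddAbove i
  have h3 : ⨆ j, delta μ (ζ j) ≤ ∑ j, delta μ (ζ j) := by
    have : Nonempty J := ⟨i⟩
    exact ciSup_le fun j => Finset.single_le_sum (f := fun j => delta μ (ζ j))
      (fun j _ => delta_nonneg (hmeas j)) (Finset.mem_univ j)
  exact Real.rpow_le_rpow_of_nonpos (by linarith) (by rw [h1]; linarith) (by norm_num)

end Smoothing

/-! ### The Stein operator of a sum of independent variables -/

section Differences

variable {H : ℕ → ℝ}

lemma abs_sub_zero_le_mul {M : ℝ} (hH : ∀ k, |H (k + 1) - H k| ≤ M) (k : ℕ) :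
    |H k - H 0| ≤ k * M := by
  induction k with
  | zero => simp
  | succ k ih =>
    have h := abs_add_le (H (k + 1) - H k) (H k - H 0)
    rw [sub_add_sub_cancel] at h
    push_cast
    linarith [hH k]

lemma abs_sub_linear_le_mul {R : ℝ}
    (hH : ∀ k, |(H (k + 2) - H (k + 1)) - (H (k + 1) - H k)| ≤ R) (k : ℕ) :
    |H k - H 0 - k * (H 1 - H 0)| ≤ (k : ℝ) * (k - 1) / 2 * R := by
  have h1 : ∀ k, |(H (k + 1) - H k) - (H 1 - H 0)| ≤ k * R :=
    abs_sub_zero_le_mul (H := fun k => H (k + 1) - H k) hH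
  induction k with
  | zero => simp
  | succ k ih =>
    have h := abs_add_le ((H (k + 1) - H k) - (H 1 - H 0)) (H k - H 0 - k * (H 1 - H 0))
    rw [show (H (k + 1) - H k) - (H 1 - H 0) + (H k - H 0 - k * (H 1 - H 0)) =
      H (k + 1) - H 0 - (k + 1) * (H 1 - H 0) by ring] at h
    push_cast
    linarith [h1 k]

lemma abs_hasSum_le_of_le {c D u : ℕ → ℝ} {S M : ℝ} (hu : Summable fun k => u k * |c k|)
    (hD : ∀ k, |D k| ≤ u k * M) (hS : HasSum (fun k => c k * D k) S) :
    |S| ≤ M * ∑' k, u k * |c k| := by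
  rw [← hS.tsum_eq, ← Real.norm_eq_abs]
  refine tsum_of_norm_bounded (hu.hasSum.mul_left M) fun k => ?_
  rw [norm_mul, Real.norm_eq_abs, Real.norm_eq_abs]
  refine (mul_le_mul_of_nonneg_left (hD k) (abs_nonneg _)).trans (le_of_eq (by ring))

end Differences

/-! ### Conditioning on one summand and discrete Taylor expansion -/

section Expansion

variable {Ω : Type*} [MeasurableSpace Ω] {μ : Measure Ω} [IsProbabilityMeasure μ] {X W : Ω → ℕ}
  {g : ℕ → ℝ} {B p : ℝ}

lemma integrable_comp_of_le_cube (hX : Measurable X)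
    (hX3 : Integrable (fun ω => (X ω : ℝ) ^ 3) μ) {u : ℕ → ℝ} {C : ℝ}
    (hu : ∀ k : ℕ, |u k| ≤ C * (1 + (k : ℝ) ^ 3)) : Integrable (fun ω => u (X ω)) μ :=
  (((integrable_const 1).add hX3).const_mul C).mono'
    (Measurable.of_discrete.comp hX).aestronglyMeasurable
    (Filter.Eventually.of_forall fun ω => hu (X ω))

lemma pow_le_one_add_cube {n : ℕ} (hn : n ≤ 3) (k : ℕ) : (k : ℝ) ^ n ≤ 1 + (k : ℝ) ^ 3 := by
  rcases Nat.eq_zero_or_pos k with rfl | hk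
  · rcases n with _ | n <;> simp
  · have : (k : ℝ) ^ n ≤ (k : ℝ) ^ 3 := pow_le_pow_right₀ (by exact_mod_cast hk) hn
    linarith

lemma integrable_pow_of_cube (hX : Measurable X)
    (hX3 : Integrable (fun ω => (X ω : ℝ) ^ 3) μ) {n : ℕ} (hn : n ≤ 3) :
    Integrable (fun ω => (X ω : ℝ) ^ n) μ :=
  integrable_comp_of_le_cube hX hX3 (u := fun k => (k : ℝ) ^ n) (C := 1) fun k => by
    rw [abs_of_nonneg (by positivity), one_mul]
    exact pow_le_one_add_cube hn k

lemma integrable_nat_of_cube (hX : Measurable X)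
    (hX3 : Integrable (fun ω => (X ω : ℝ) ^ 3) μ) : Integrable (fun ω => (X ω : ℝ)) μ := by
  simpa using integrable_pow_of_cube hX hX3 (n := 1) (by norm_num)

lemma hasSum_gam_mul_pow (hX : Measurable X) (hX3 : Integrable (fun ω => (X ω : ℝ) ^ 3) μ) {n : ℕ}
    (hn : n ≤ 3) : HasSum (fun k => gam μ X k * (k : ℝ) ^ n) (∫ ω, (X ω : ℝ) ^ n ∂μ) :=
  hasSum_gam_mul hX (u := fun k => (k : ℝ) ^ n) (integrable_pow_of_cube hX hX3 hn)

lemma hasSum_gam_mul_nat (hX : Measurable X) (hX3 : Integrable (fun ω => (X ω : ℝ) ^ 3) μ) :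
    HasSum (fun k => gam μ X k * k) (mean μ X) := by
  simpa [mean] using hasSum_gam_mul_pow hX hX3 (n := 1) (by norm_num)

/-- The coefficients are of order k γ_k and (k+1) γ_{k+1}, so a quadratic weight calls for third
moments. This one series dominates those in U₁ and U₂. -/
lemma summable_sq_mul_abs_coeff (hp0 : 0 < p) (hp1 : p < 1) (hX : Measurable X)
    (hX3 : Integrable (fun ω => (X ω : ℝ) ^ 3) μ) :
    Summable fun k : ℕ => (k : ℝ) ^ 2 * |coeff μ p X k| := by
  have h2 := (hasSum_gam_mul_pow hX hX3 (n := 2) (by norm_num)).summable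
  have h3 := (hasSum_gam_mul_pow hX hX3 (n := 3) le_rfl).summable
  have h4 := (summable_nat_add_iff 1).2 h3
  refine Summable.of_nonneg_of_le (fun k => by positivity) (fun k => ?_)
    (((h2.mul_left (p * mean μ X)).add (h3.mul_left (1 - p))).add h4)
  have hm := mean_nonneg (μ := μ) X
  have hg0 := gam_nonneg (μ := μ) X k
  have hg1 := gam_nonneg (μ := μ) X (k + 1)
  have hq : 0 ≤ 1 - p := by linarith
  have h : |coeff μ p X k| ≤ (p * mean μ X + (1 - p) * k) * gam μ X k +
      ((k : ℝ) + 1) * gam μ X (k + 1) := by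
    rw [coeff]
    refine (abs_sub _ _).trans (le_of_eq ?_)
    rw [abs_of_nonneg (by positivity), abs_of_nonneg (by positivity)]
  refine (mul_le_mul_of_nonneg_left h (by positivity)).trans ?_
  push_cast
  have h5 : (k : ℝ) ^ 2 * (((k : ℝ) + 1) * gam μ X (k + 1)) ≤
      gam μ X (k + 1) * ((k : ℝ) + 1) ^ 3 := by
    have : (k : ℝ) ^ 2 ≤ ((k : ℝ) + 1) ^ 2 := by
      have := Nat.cast_nonneg (α := ℝ) k
      nlinarith
    calc _ ≤ ((k : ℝ) + 1) ^ 2 * (((k : ℝ) + 1) * gam μ X (k + 1)) :=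
          mul_le_mul_of_nonneg_right this (by positivity)
      _ = _ := by ring
  linarith

lemma nat_le_sq (k : ℕ) : (k : ℝ) ≤ (k : ℝ) ^ 2 := by
  exact_mod_cast Nat.le_self_pow two_ne_zero k

lemma summable_mul_abs_coeff (hp0 : 0 < p) (hp1 : p < 1) (hX : Measurable X)
    (hX3 : Integrable (fun ω => (X ω : ℝ) ^ 3) μ) :
    Summable fun k : ℕ => (k : ℝ) * |coeff μ p X k| :=
  Summable.of_nonneg_of_le (fun k => by positivity)
    (fun k => mul_le_mul_of_nonneg_right (nat_le_sq k) (abs_nonneg _))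
    (summable_sq_mul_abs_coeff hp0 hp1 hX hX3)

lemma summable_choose_two_mul_abs_coeff (hp0 : 0 < p) (hp1 : p < 1) (hX : Measurable X)
    (hX3 : Integrable (fun ω => (X ω : ℝ) ^ 3) μ) :
    Summable fun k : ℕ => (k : ℝ) * ((k : ℝ) - 1) / 2 * |coeff μ p X k| := by
  refine Summable.of_nonneg_of_le (fun k => ?_)
    (fun k => mul_le_mul_of_nonneg_right ?_ (abs_nonneg _))
    (summable_sq_mul_abs_coeff hp0 hp1 hX hX3)
  · have := nat_le_sq k
    exact mul_nonneg (by linarith) (abs_nonneg _)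
  · have := Nat.cast_nonneg (α := ℝ) k
    nlinarith

/-- The summand of `𝒜 g (V)` that belongs to `X`, where `V = X + W`. -/
noncomputable def steinPart (μ : Measure Ω) (p : ℝ) (g : ℕ → ℝ) (X V : Ω → ℕ) (ω : Ω) : ℝ :=
  (p * mean μ X + (1 - p) * X ω) * g (V ω + 1) - X ω * g (V ω)

lemma integrable_mul_comp (hX : Measurable X) (hW : Measurable W)
    (hX3 : Integrable (fun ω => (X ω : ℝ) ^ 3) μ) (hg : ∀ k, |g k| ≤ B) (a b : ℝ) :
    Integrable (fun ω => (a + b * X ω) * g (W ω)) μ :=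
  ((integrable_const a).add ((integrable_nat_of_cube hX hX3).const_mul b)).mul_bdd
    (c := B) (Measurable.of_discrete.comp hW).aestronglyMeasurable
    (Filter.Eventually.of_forall fun ω => hg (W ω))

lemma integrable_steinPart {V : Ω → ℕ} (hX : Measurable X) (hV : Measurable V)
    (hX3 : Integrable (fun ω => (X ω : ℝ) ^ 3) μ) (hg : ∀ k, |g k| ≤ B) :
    Integrable (steinPart μ p g X V) μ := by
  have h1 := integrable_mul_comp (g := g) hX (hV.add_const 1) hX3 hg (p * mean μ X) (1 - p)
  have h2 := integrable_mul_comp hX hV hX3 hg 0 1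
  simp only [zero_add, one_mul] at h2
  exact h1.sub h2

/-- The term X g(X + W) contributes nothing at X = 0; shifting its index by one pairs both terms
with the same g(k + 1 + W). -/
lemma hasSum_coeff_mul (hX : Measurable X) (hW : Measurable W) (hi : IndepFun X W μ)
    (hX3 : Integrable (fun ω => (X ω : ℝ) ^ 3) μ) (hg : ∀ k, |g k| ≤ B) :
    HasSum (fun k => coeff μ p X k * ∫ ω, g (k + 1 + W ω) ∂μ)
      (∫ ω, steinPart μ p g X (fun ω => X ω + W ω) ω ∂μ) := by
  have i1 := integrable_mul_comp (g := g) hX ((hX.add hW).add_const 1) hX3 hg (p * mean μ X) (1 - p)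
  have i2 := integrable_mul_comp hX (hX.add hW) hX3 hg 0 1
  simp only [zero_add, one_mul] at i2
  have h1 := hasSum_gam_mul_of_indepFun hX hW hi
    (F := fun k w => (p * mean μ X + (1 - p) * k) * g (k + w + 1)) i1
  have h2 := (hasSum_nat_add_iff' 1).2 (hasSum_gam_mul_of_indepFun hX hW hi
    (F := fun k w => k * g (k + w)) i2)
  have e : ∫ ω, steinPart μ p g X (fun ω => X ω + W ω) ω ∂μ = _ := integral_sub i1 i2
  rw [e]
  simp only [Finset.range_one, Finset.sum_singleton, Nat.cast_zero, zero_mul, integral_zero,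
    mul_zero, sub_zero] at h2
  refine (h1.sub h2).congr_fun fun k => ?_
  simp only [integral_const_mul, coeff, Nat.cast_add, Nat.cast_one, add_right_comm k _ 1]
  ring

lemma hasSum_coeff (hX : Measurable X) (hX3 : Integrable (fun ω => (X ω : ℝ) ^ 3) μ) :
    HasSum (coeff μ p X) 0 := by
  have h1 := ((hasSum_gam (μ := μ) hX).mul_left (p * mean μ X)).add
    ((hasSum_gam_mul_nat hX hX3).mul_left (1 - p))
  have h2 := (hasSum_nat_add_iff' 1).2 (hasSum_gam_mul_nat hX hX3)
  have h := h1.sub h2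
  simp only [Finset.range_one, Finset.sum_singleton, Nat.cast_zero, mul_zero, sub_zero] at h
  rw [show p * mean μ X * 1 + (1 - p) * mean μ X - mean μ X = 0 by ring] at h
  refine h.congr_fun fun k => ?_
  rw [coeff]; push_cast; ring

/-- The first moment of the coefficients. -/
noncomputable def coeffMoment (μ : Measure Ω) (p : ℝ) (X : Ω → ℕ) : ℝ :=
  p * mean μ X ^ 2 + (1 - p) * (∫ ω, (X ω : ℝ) ^ 2 ∂μ) - ∫ ω, (X ω : ℝ) * ((X ω : ℝ) - 1) ∂μ

lemma integral_mul_sub_one (hX : Measurable X) (hX3 : Integrable (fun ω => (X ω : ℝ) ^ 3) μ) :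
    ∫ ω, (X ω : ℝ) * ((X ω : ℝ) - 1) ∂μ = ∫ ω, (X ω : ℝ) ^ 2 ∂μ - mean μ X := by
  rw [mean, ← integral_sub (integrable_pow_of_cube hX hX3 (by norm_num))
    (integrable_nat_of_cube hX hX3)]
  exact integral_congr_ae (Filter.Eventually.of_forall fun ω => by ring)

lemma hasSum_coeff_mul_nat (hX : Measurable X) (hX3 : Integrable (fun ω => (X ω : ℝ) ^ 3) μ) :
    HasSum (fun k => coeff μ p X k * k) (coeffMoment μ p X) := by
  have g1 := hasSum_gam_mul_nat hX hX3
  have g2 := hasSum_gam_mul_pow hX hX3 (n := 2) (by norm_num)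
  have h1 := (g1.mul_left (p * mean μ X)).add (g2.mul_left (1 - p))
  have h2 := (hasSum_nat_add_iff' 1).2 (g2.sub g1)
  have h := h1.sub h2
  simp only [Finset.range_one, Finset.sum_singleton, Nat.cast_zero, mul_zero, sub_zero, ne_eq,
    OfNat.ofNat_ne_zero, not_false_eq_true, zero_pow] at h
  rw [coeffMoment, integral_mul_sub_one hX hX3]
  rw [mul_assoc, ← sq] at h
  refine h.congr_fun fun k => ?_
  rw [coeff]; push_cast; ring

/-- The coefficients sum to zero, so the value at k = 0 may be subtracted, and k increments of size
at most M remain. -/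
lemma abs_integral_steinPart_le (hp0 : 0 < p) (hp1 : p < 1) (hX : Measurable X) (hW : Measurable W)
    (hi : IndepFun X W μ) (hX3 : Integrable (fun ω => (X ω : ℝ) ^ 3) μ) (hg : ∀ k, |g k| ≤ B)
    {M : ℝ} (hM : ∀ k, |g (k + 2) - g (k + 1)| ≤ M) :
    |∫ ω, steinPart μ p g X (fun ω => X ω + W ω) ω ∂μ| ≤
      M * ∑' k : ℕ, (k : ℝ) * |coeff μ p X k| := by
  have hgi : ∀ k, Integrable (fun ω => g (k + 1 + W ω)) μ := fun k =>
    integrable_comp_of_bounded (measurable_const.add hW) hg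
  have h := (hasSum_coeff_mul (p := p) hX hW hi hX3 hg).sub
    ((hasSum_coeff (p := p) hX hX3).mul_right (∫ ω, g (0 + 1 + W ω) ∂μ))
  rw [zero_mul, sub_zero] at h
  refine abs_hasSum_le_of_le (summable_mul_abs_coeff hp0 hp1 hX hX3) (fun k => ?_)
    (h.congr_fun fun k => mul_sub _ _ _)
  refine abs_sub_zero_le_mul (H := fun k => ∫ ω, g (k + 1 + W ω) ∂μ) (fun k => ?_) k
  have hM' : ∀ᵐ ω ∂μ, ‖g (k + 1 + 1 + W ω) - g (k + 1 + W ω)‖ ≤ M :=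
    Filter.Eventually.of_forall fun ω => by
      have := hM (k + W ω)
      rwa [show k + W ω + 2 = k + 1 + 1 + W ω by ring,
        show k + W ω + 1 = k + 1 + W ω by ring] at this
  rw [← integral_sub (hgi _) (hgi _), ← Real.norm_eq_abs]
  simpa using norm_integral_le_of_norm_le_const hM'

/-- Second-order expansion around k = 0. The subtracted expectation depends on X + W only, so it is
the same for every summand of V and can be cancelled later by variance matching. -/
lemma abs_integral_steinPart_sub_le (hp0 : 0 < p) (hp1 : p < 1) (hX : Measurable X)
    (hW : Measurable W) (hi : IndepFun X W μ) (hX3 : Integrable (fun ω => (X ω : ℝ) ^ 3) μ)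
    (hg : ∀ k, |g k| ≤ B) {R : ℝ}
    (hR : ∀ k, |∫ ω, (g (k + 1 + 2 + W ω) - g (k + 1 + 1 + W ω)) ∂μ -
      ∫ ω, (g (k + 1 + 1 + W ω) - g (k + 1 + W ω)) ∂μ| ≤ R) :
    |∫ ω, steinPart μ p g X (fun ω => X ω + W ω) ω ∂μ -
      coeffMoment μ p X * ∫ ω, (g (X ω + W ω + 2) - g (X ω + W ω + 1)) ∂μ| ≤
      R * (mean μ X * |coeffMoment μ p X| +
        ∑' k : ℕ, (k : ℝ) * ((k : ℝ) - 1) / 2 * |coeff μ p X k|) := by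
  have hgi : ∀ k, Integrable (fun ω => g (k + 1 + W ω)) μ := fun k =>
    integrable_comp_of_bounded (measurable_const.add hW) hg
  let H : ℕ → ℝ := fun k => ∫ ω, g (k + 1 + W ω) ∂μ
  have hH : ∀ k, H (k + 1) - H k = ∫ ω, (g (k + 1 + 1 + W ω) - g (k + 1 + W ω)) ∂μ := fun k =>
    (integral_sub (hgi _) (hgi _)).symm
  have hH2 : ∀ k, |(H (k + 2) - H (k + 1)) - (H (k + 1) - H k)| ≤ R := fun k => by
    rw [hH (k + 1), hH k]
    exact hR k
  have h1 : |∫ ω, steinPart μ p g X (fun ω => X ω + W ω) ω ∂μ -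
      coeffMoment μ p X * (H 1 - H 0)| ≤
      R * ∑' k : ℕ, (k : ℝ) * ((k : ℝ) - 1) / 2 * |coeff μ p X k| := by
    have h := ((hasSum_coeff_mul (p := p) hX hW hi hX3 hg).sub
      ((hasSum_coeff (p := p) hX hX3).mul_right (H 0))).sub
      ((hasSum_coeff_mul_nat (p := p) hX hX3).mul_right (H 1 - H 0))
    rw [zero_mul, sub_zero] at h
    exact abs_hasSum_le_of_le (summable_choose_two_mul_abs_coeff hp0 hp1 hX hX3)
      (abs_sub_linear_le_mul hH2) (h.congr_fun fun k => by ring)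
  -- Passing from the increment at W to the one at X + W takes X steps of size at most R; this
  -- produces the mean times first moment term of U₂.
  have h2 : |∫ ω, (g (X ω + W ω + 2) - g (X ω + W ω + 1)) ∂μ - (H 1 - H 0)| ≤ mean μ X * R := by
    have hF := hasSum_gam_mul_of_indepFun hX hW hi
      (F := fun k w => g (k + w + 2) - g (k + w + 1))
      ((integrable_comp_of_bounded ((hX.add hW).add_const 2) hg).sub
        (integrable_comp_of_bounded ((hX.add hW).add_const 1) hg))
    have hF2 : HasSum (fun k => gam μ X k * ((H (k + 1) - H k) - (H 1 - H 0)))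
        (∫ ω, (g (X ω + W ω + 2) - g (X ω + W ω + 1)) ∂μ - (H 1 - H 0)) := by
      have h := hF.sub ((hasSum_gam (μ := μ) hX).mul_right (H 1 - H 0))
      rw [one_mul] at h
      refine h.congr_fun fun k => ?_
      rw [hH k, mul_sub]
      simp only [add_right_comm k _ 1, add_right_comm k _ 2]
    have h3 := abs_hasSum_le_of_le (u := fun k : ℕ => (k : ℝ)) (M := R)
      ((hasSum_gam_mul_nat hX hX3).summable.congr fun k => by
        rw [abs_of_nonneg (gam_nonneg X k), mul_comm])
      (abs_sub_zero_le_mul (H := fun k => H (k + 1) - H k) hH2) hF2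
    rw [← (hasSum_gam_mul_nat hX hX3).tsum_eq, mul_comm]
    simpa only [abs_of_nonneg (gam_nonneg (μ := μ) X _), mul_comm] using h3
  have h4 : |coeffMoment μ p X * (∫ ω, (g (X ω + W ω + 2) - g (X ω + W ω + 1)) ∂μ - (H 1 - H 0))| ≤
      |coeffMoment μ p X| * (mean μ X * R) := by
    rw [abs_mul]
    exact mul_le_mul_of_nonneg_left h2 (abs_nonneg _)
  have h5 := abs_sub (∫ ω, steinPart μ p g X (fun ω => X ω + W ω) ω ∂μ -
    coeffMoment μ p X * (H 1 - H 0))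
    (coeffMoment μ p X * (∫ ω, (g (X ω + W ω + 2) - g (X ω + W ω + 1)) ∂μ - (H 1 - H 0)))
  rw [show ∀ a b c d : ℝ, a - b * c - b * (d - c) = a - b * d by intros; ring] at h5
  linarith

end Expansion

lemma eq_add_sum_erase {Ω J : Type*} [Fintype J] [DecidableEq J] {ζ : J → Ω → ℕ} {V : Ω → ℕ}
    (hV : ∀ ω, V ω = ∑ i, ζ i ω) (i : J) :
    V = fun ω => ζ i ω + ∑ j ∈ Finset.univ.erase i, ζ j ω := by
  ext ω
  rw [hV]
  exact (Finset.add_sum_erase Finset.univ (fun j => ζ j ω) (Finset.mem_univ i)).symm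

/-! ### Summation over the index set and moment matching -/

section Sum

variable {Ω : Type*} [MeasurableSpace Ω] {μ : Measure Ω} [IsProbabilityMeasure μ]
  {J : Type*} [Fintype J] {ζ : J → Ω → ℕ} {V : Ω → ℕ} {r p B M : ℝ} {g : ℕ → ℝ}

lemma measurable_of_eq_sum (hmeas : ∀ i, Measurable (ζ i)) (hV : ∀ ω, V ω = ∑ i, ζ i ω) :
    Measurable V := by
  rw [funext hV]
  exact measurable_sum_nat hmeas Finset.univ

lemma integrable_of_eq_sum (hmeas : ∀ i, Measurable (ζ i))
    (hmom : ∀ i, Integrable (fun ω => (ζ i ω : ℝ) ^ 3) μ) (hV : ∀ ω, V ω = ∑ i, ζ i ω) :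
    Integrable (fun ω => (V ω : ℝ)) μ := by
  simp only [hV, Nat.cast_sum]
  exact integrable_finsetSum _ fun i _ => integrable_nat_of_cube (hmeas i) (hmom i)

lemma mean_eq_sum (hmeas : ∀ i, Measurable (ζ i))
    (hmom : ∀ i, Integrable (fun ω => (ζ i ω : ℝ) ^ 3) μ) (hV : ∀ ω, V ω = ∑ i, ζ i ω) :
    mean μ V = ∑ i, mean μ (ζ i) := by
  simp only [mean, hV, Nat.cast_sum]
  exact integral_finsetSum _ fun i _ => integrable_nat_of_cube (hmeas i) (hmom i)

lemma memLp_two_of_cube {X : Ω → ℕ} (hX : Measurable X)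
    (hX3 : Integrable (fun ω => (X ω : ℝ) ^ 3) μ) : MemLp (fun ω => (X ω : ℝ)) 2 μ :=
  (memLp_two_iff_integrable_sq (Measurable.of_discrete.comp hX).aestronglyMeasurable).2
    (integrable_pow_of_cube hX hX3 (by norm_num))

lemma var_eq_sum (hmeas : ∀ i, Measurable (ζ i)) (hindep : iIndepFun ζ μ)
    (hmom : ∀ i, Integrable (fun ω => (ζ i ω : ℝ) ^ 3) μ) (hV : ∀ ω, V ω = ∑ i, ζ i ω) :
    var μ V = ∑ i, var μ (ζ i) := by
  have h := IndepFun.variance_sum (μ := μ) (X := fun i ω => (ζ i ω : ℝ)) (s := Finset.univ)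
    (fun i _ => memLp_two_of_cube (hmeas i) (hmom i))
    (fun i _ j _ hij => (hindep.indepFun hij).comp (φ := fun n : ℕ => (n : ℝ))
      (ψ := fun n : ℕ => (n : ℝ)) Measurable.of_discrete Measurable.of_discrete)
  simp only [var]
  rw [← h]
  congr 1
  ext ω
  simp [hV]

lemma var_eq_sub {X : Ω → ℕ} (hX : Measurable X) (hX3 : Integrable (fun ω => (X ω : ℝ) ^ 3) μ) :
    var μ X = ∫ ω, (X ω : ℝ) ^ 2 ∂μ - mean μ X ^ 2 := by
  rw [var, variance_eq_sub (memLp_two_of_cube hX hX3)]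
  rfl

lemma integrable_steinOp_steinSol {z : ℝ} (hr : 0 < r) (hp0 : 0 < p) (hp1 : p < 1) (hz : 0 ≤ z)
    (hVm : Measurable V) (hV : Integrable (fun ω => (V ω : ℝ)) μ) :
    Integrable (fun ω => steinOp r p (steinSol r p z) (V ω)) μ := by
  simp only [steinOp_steinSol hr hp0 hp1 hz]
  refine Integrable.sub ?_ (integrable_const _)
  refine hV.mono' ((Measurable.of_discrete (f := callFn z)).comp hVm).aestronglyMeasurable
    (Filter.Eventually.of_forall fun ω => ?_)
  rw [Real.norm_of_nonneg (callFn_nonneg _ _)]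
  exact max_le (by linarith) (Nat.cast_nonneg _)

lemma integral_steinOp_eq_sum (hp0 : 0 < p) (hmeas : ∀ i, Measurable (ζ i))
    (hmom : ∀ i, Integrable (fun ω => (ζ i ω : ℝ) ^ 3) μ) (hV : ∀ ω, V ω = ∑ i, ζ i ω)
    (hmean : r * (1 - p) / p = mean μ V) (hg : ∀ k, |g k| ≤ B) :
    ∫ ω, steinOp r p g (V ω) ∂μ = ∑ i, ∫ ω, steinPart μ p g (ζ i) V ω ∂μ := by
  rw [← integral_finsetSum _ fun i _ =>
    integrable_steinPart (hmeas i) (measurable_of_eq_sum hmeas hV) (hmom i) hg]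
  refine integral_congr_ae (Filter.Eventually.of_forall fun ω => ?_)
  have hc : (V ω : ℝ) = ∑ i, (ζ i ω : ℝ) := by rw [hV]; push_cast; rfl
  have hm : r * (1 - p) = p * ∑ i, mean μ (ζ i) := by
    rw [← mean_eq_sum hmeas hmom hV, ← hmean]
    field_simp
  simp only [steinOp, steinPart, Finset.sum_sub_distrib, ← Finset.sum_mul, Finset.sum_add_distrib,
    ← Finset.mul_sum, ← hc, ← hm]
  ring

/-- Each first moment equals 𝔼ζ_i - p Var ζ_i, and the negative binomial law has mean p times its
variance. -/
lemma sum_coeffMoment_eq_zero (hp0 : 0 < p) (hmeas : ∀ i, Measurable (ζ i))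
    (hindep : iIndepFun ζ μ) (hmom : ∀ i, Integrable (fun ω => (ζ i ω : ℝ) ^ 3) μ)
    (hV : ∀ ω, V ω = ∑ i, ζ i ω) (hmean : r * (1 - p) / p = mean μ V)
    (hvar : r * (1 - p) / p ^ 2 = var μ V) : ∑ i, coeffMoment μ p (ζ i) = 0 := by
  have h : ∀ i, coeffMoment μ p (ζ i) = mean μ (ζ i) - p * var μ (ζ i) := fun i => by
    rw [coeffMoment, integral_mul_sub_one (hmeas i) (hmom i), var_eq_sub (hmeas i) (hmom i)]
    ring
  simp only [h]
  rw [Finset.sum_sub_distrib, ← Finset.mul_sum, ← mean_eq_sum hmeas hmom hV,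
    ← var_eq_sum hmeas hindep hmom hV, ← hmean, ← hvar]
  field_simp
  ring

variable [DecidableEq J]

lemma abs_integral_steinOp_le_U₁ (hp0 : 0 < p) (hp1 : p < 1) (hmeas : ∀ i, Measurable (ζ i))
    (hindep : iIndepFun ζ μ) (hmom : ∀ i, Integrable (fun ω => (ζ i ω : ℝ) ^ 3) μ)
    (hV : ∀ ω, V ω = ∑ i, ζ i ω) (hmean : r * (1 - p) / p = mean μ V) (hg : ∀ k, |g k| ≤ B)
    (hM0 : ∀ k, g (k + 2) ≤ g (k + 1)) (hM : ∀ k, g (k + 1) - g (k + 2) ≤ M) :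
    |∫ ω, steinOp r p g (V ω) ∂μ| ≤ M * U₁ μ p ζ := by
  rw [integral_steinOp_eq_sum hp0 hmeas hmom hV hmean hg, U₁, Finset.mul_sum]
  refine (Finset.abs_sum_le_sum_abs _ _).trans (Finset.sum_le_sum fun i _ => ?_)
  rw [eq_add_sum_erase hV i]
  refine abs_integral_steinPart_le hp0 hp1 (hmeas i) (measurable_sum_nat hmeas _)
    (indepFun_sum hmeas hindep (Finset.notMem_erase i _)) (hmom i) hg fun k => ?_
  rw [abs_sub_comm, abs_of_nonneg (sub_nonneg.2 (hM0 k))]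
  exact hM k

lemma abs_integral_steinOp_le_U₂ (hp0 : 0 < p) (hp1 : p < 1) (hmeas : ∀ i, Measurable (ζ i))
    (hindep : iIndepFun ζ μ) (hmom : ∀ i, Integrable (fun ω => (ζ i ω : ℝ) ^ 3) μ)
    (hV : ∀ ω, V ω = ∑ i, ζ i ω) (hmean : r * (1 - p) / p = mean μ V)
    (hvar : r * (1 - p) / p ^ 2 = var μ V) (hg : ∀ k, |g k| ≤ B)
    (hM0 : ∀ k, g (k + 2) ≤ g (k + 1)) (hM : ∀ k, g (k + 1) - g (k + 2) ≤ M) :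
    |∫ ω, steinOp r p g (V ω) ∂μ| ≤ M * U₂ μ p ζ := by
  have hMnn : 0 ≤ M := (sub_nonneg.2 (hM0 0)).trans (hM 0)
  have hs := sum_coeffMoment_eq_zero hp0 hmeas hindep hmom hV hmean hvar
  have e : ∑ i, ∫ ω, steinPart μ p g (ζ i) V ω ∂μ =
      ∑ i, (∫ ω, steinPart μ p g (ζ i) V ω ∂μ -
        coeffMoment μ p (ζ i) * ∫ ω, (g (V ω + 2) - g (V ω + 1)) ∂μ) := by
    rw [Finset.sum_sub_distrib, ← Finset.sum_mul, hs, zero_mul, sub_zero]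
  -- All these increments lie in [-M, 0], so their oscillation is M and not 2M; monotonicity of g
  -- saves the factor 2.
  have hosc : ∀ x y, |(g (x + 2) - g (x + 1)) - (g (y + 2) - g (y + 1))| ≤ M := fun x y => by
    rw [abs_le]
    constructor <;> linarith [hM0 x, hM0 y, hM x, hM y]
  rw [integral_steinOp_eq_sum hp0 hmeas hmom hV hmean hg, e, U₂, ← Finset.sum_add_distrib,
    ← mul_assoc, Finset.mul_sum]
  refine (Finset.abs_sum_le_sum_abs _ _).trans (Finset.sum_le_sum fun i _ => ?_)
  have hVi := eq_add_sum_erase hV i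
  subst hVi
  refine abs_integral_steinPart_sub_le hp0 hp1 (hmeas i) (measurable_sum_nat hmeas _)
    (indepFun_sum hmeas hindep (Finset.notMem_erase i _)) (hmom i) hg fun k => ?_
  have h := abs_integral_shift_sub_le hmeas hindep (Finset.univ.erase i) hosc 1 k
  refine le_trans (le_of_eq ?_)
    (h.trans (mul_le_mul_of_nonneg_left (survival_erase_le_smooth hmeas i) hMnn))
  congr 2 <;>
  · refine integral_congr_ae (Filter.Eventually.of_forall fun ω => ?_)
    dsimp only
    congr 2 <;> omega

end Sum

end NBCall

theorem theorem3p2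
    {Ω : Type*} [MeasurableSpace Ω] (μ : Measure Ω) [IsProbabilityMeasure μ]
    {J : Type*} [Fintype J] (ζ : J → Ω → ℕ)
    (hmeas : ∀ i, Measurable (ζ i))
    (hindep : iIndepFun ζ μ)
    (hmom : ∀ i, Integrable (fun ω => (ζ i ω : ℝ) ^ 3) μ)
    (V : Ω → ℕ) (hV : ∀ ω, V ω = ∑ i, ζ i ω)
    (r p : ℝ) (hr : 1 < r) (hp0 : 0 < p) (hp1 : p < 1) :
    -- all series and expectations in the statement converge
    (∀ z : ℝ, 0 ≤ z →
      (∀ k : ℕ, 1 ≤ k → Summable fun m : ℕ => steinTerm r p z k (k + m)) ∧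
      Integrable (fun ω => steinOp r p (steinSol r p z) (V ω)) μ) ∧
    (∀ i, Summable (fun k : ℕ => (k : ℝ) * |coeff μ p (ζ i) k|) ∧
      Summable (fun k : ℕ => (k : ℝ) * ((k : ℝ) - 1) / 2 * |coeff μ p (ζ i) k|)) ∧
    -- matching of the means
    (mean (nbMeasure r p) id = mean μ V →
      (∀ z : ℝ, 0 ≤ z →
        |∫ ω, steinOp r p (steinSol r p z) (V ω) ∂μ|
          ≤ (2 * p ^ (-(r + 1)) - p⁻¹) * U₁ μ p ζ) ∧
      (∀ z : ℝ, 1 < z →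
        |∫ ω, steinOp r p (steinSol r p z) (V ω) ∂μ| ≤ theta r p z * U₁ μ p ζ)) ∧
    -- matching of the means and of the variances
    (mean (nbMeasure r p) id = mean μ V → var (nbMeasure r p) id = var μ V →
      (∀ z : ℝ, 0 ≤ z →
        |∫ ω, steinOp r p (steinSol r p z) (V ω) ∂μ|
          ≤ (2 * p ^ (-(r + 1)) - p⁻¹) * U₂ μ p ζ) ∧
      (∀ z : ℝ, 1 < z →
        |∫ ω, steinOp r p (steinSol r p z) (V ω) ∂μ| ≤ theta r p z * U₂ μ p ζ)) := by
  classical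
  have hr0 : 0 < r := by linarith
  have hVm := measurable_of_eq_sum hmeas hV
  have hanti : ∀ z : ℝ, 0 ≤ z → ∀ k, steinSol r p z (k + 2) ≤ steinSol r p z (k + 1) :=
    fun z hz k => steinSol_succ_le hr0 hp0 hp1 hz (Nat.succ_pos k)
  rw [mean_nbMeasure hr0 hp0 hp1, var_nbMeasure hr0 hp0 hp1]
  refine ⟨fun z hz => ⟨fun k hk => (hasSum_steinTerm hr0 hp0 hp1 hz hk).summable,
      integrable_steinOp_steinSol hr0 hp0 hp1 hz hVm (integrable_of_eq_sum hmeas hmom hV)⟩,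
    fun i => ⟨summable_mul_abs_coeff hp0 hp1 (hmeas i) (hmom i),
      summable_choose_two_mul_abs_coeff hp0 hp1 (hmeas i) (hmom i)⟩,
    fun hmean => ⟨fun z hz => ?_, fun z hz => ?_⟩,
    fun hmean hvar => ⟨fun z hz => ?_, fun z hz => ?_⟩⟩
  · exact abs_integral_steinOp_le_U₁ hp0 hp1 hmeas hindep hmom hV hmean
      (abs_steinSol_le hr0 hp0 hp1 hz) (hanti z hz)
      fun k => steinSol_sub_le_uniform hr hp0 hp1 hz (k + 1)
  · have hz0 : 0 < z := by linarith
    exact abs_integral_steinOp_le_U₁ hp0 hp1 hmeas hindep hmom hV hmean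
      (abs_steinSol_le hr0 hp0 hp1 hz0.le) (hanti z hz0.le)
      fun k => steinSol_sub_le_theta hr hp0 hp1 hz0 (Nat.succ_pos k)
  · exact abs_integral_steinOp_le_U₂ hp0 hp1 hmeas hindep hmom hV hmean hvar
      (abs_steinSol_le hr0 hp0 hp1 hz) (hanti z hz)
      fun k => steinSol_sub_le_uniform hr hp0 hp1 hz (k + 1)
  · have hz0 : 0 < z := by linarith
    exact abs_integral_steinOp_le_U₂ hp0 hp1 hmeas hindep hmom hV hmean hvar
      (abs_steinSol_le hr0 hp0 hp1 hz0.le) (hanti z hz0.le)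
      fun k => steinSol_sub_le_theta hr hp0 hp1 hz0 (Nat.succ_pos k)
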